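/- Let $d,s,N,L$ be positive integers. A ReLU network with $d$ inputs and one output is a composition $\mathcal L_{D}\circ\sigma\circ\mathcal L_{D-1}\circ\sigma\circ\cdots\circ\sigma\circ\mathcal L_0$ of affine maps $\mathcal L_i$ with the ReLU $\sigma(x)=\max\{0,x\}$ applied coordinatewise; its depth $D$ is the number of hidden layers and its width is the maximal number of nodes in a hidden layer. "Width $W$ and depth $D$" below means width at most $W$ and depth at most $D$. For $K\in\{1,2,\dots\}$ and $\delta\in(0,\tfrac1K)$ let $$\Omega([0,1]^d,K,\delta)=\bigcup_{i=1}^d\Big\{x\in[0,1]^d:\ x_i\in\bigcup_{k=1}^{K-1}\big(\tfrac kK-\delta,\tfrac kK\big)\Big\}.$$ **Theorem.** Let $f\in C^s([0,1]^d)$ satisfy $\|\partial^{\alpha}f\|_{L^\infty([0,1]^d)}\le 1$ for every multi-index $\alpha\in\mathbb N^d$ with $|\alpha|=\alpha_1+\cdots+\alpha_d\le s$. Put $K=\lfloor N^{1/d}\rfloor^2\lfloor L^{2/d}\rfloor$ and let $\delta\in(0,\tfrac1{3K}]$ be arbitrary. Then there is a function $\phi:\mathbb R^d\to\mathbb R$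 implemented by a ReLU network of width $16s^{d+1}d(N+2)\log_2(8N)$ and depth $18s^2(L+2)\log_2(4L)$ such that $$|\phi(x)-f(x)|\le 84(s+1)^d8^sN^{-2s/d}L^{-2s/d}\qquad\text{for all }x\in[0,1]^d\setminus\Omega([0,1]^d,K,\delta).$$ -/

import Mathlib

open MeasureTheory Set
open scoped ENNReal

namespace ReLUApprox

/-- A fully connected feed-forward ReLU network with `n` inputs and `m` outputs: a chain of hidden
layers, each an affine map followed by the componentwise ReLU, ended by an affine output layer. -/
inductive Net (m : ℕ) : ℕ → Type
  | output {n : ℕ} (W : Matrix (Fin m) (Fin n) ℝ) (b : Fin m → ℝ) : Net m n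
  | hidden {n k : ℕ} (W : Matrix (Fin k) (Fin n) ℝ) (b : Fin k → ℝ) (rest : Net m k) : Net m n

/-- The rectified linear unit, `σ(x) = max {0, x}`, applied to each coordinate. -/
def relu {k : ℕ} (x : Fin k → ℝ) : Fin k → ℝ := fun i => max 0 (x i)

/-- The function `ℝⁿ → ℝᵐ` implemented by a network. -/
def Net.eval {m : ℕ} : {n : ℕ} → Net m n → (Fin n → ℝ) → (Fin m → ℝ)
  | _, .output W b, x => W.mulVec x + b
  | _, .hidden W b rest, x => rest.eval (relu (W.mulVec x + b))

/-- The depth: the number of hidden layers. -/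
def Net.depth {m : ℕ} : {n : ℕ} → Net m n → ℕ
  | _, .output _ _ => 0
  | _, .hidden _ _ rest => rest.depth + 1

/-- The width: the maximal number of nodes in a hidden layer. -/
def Net.width {m : ℕ} : {n : ℕ} → Net m n → ℕ
  | _, .output _ _ => 0
  | _, .hidden (k := k) _ _ rest => max k rest.width

/-- `φ : ℝᵈ → ℝ` is implemented by a ReLU network of width at most `w` and depth at most `l`.
The bounds are real numbers, since the sizes of interest involve logarithms. -/
def Implementable {d : ℕ} (φ : (Fin d → ℝ) → ℝ) (w l : ℝ) : Prop :=
  ∃ net : Net 1 d, (net.width : ℝ) ≤ w ∧ (net.depth : ℝ) ≤ l ∧ ∀ x, φ x = net.eval x 0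

/-- The closed unit cube `[0,1]ᵈ`. -/
def cube (d : ℕ) : Set (Fin d → ℝ) := Icc 0 1

/-- The partial derivative `∂f/∂xᵢ` of a function on `[0,1]ᵈ` (one-sided on the faces). -/
noncomputable def partialDeriv {d : ℕ} (i : Fin d) (f : (Fin d → ℝ) → ℝ) : (Fin d → ℝ) → ℝ :=
  fun x => lineDerivWithin ℝ f (cube d) x (Pi.single i 1)

/-- `∂^α f = ∂₁^{α₁} ∂₂^{α₂} ⋯ ∂_d^{α_d} f` on `[0,1]ᵈ`. -/
noncomputable def multiDeriv {d : ℕ} (α : Fin d → ℕ) (f : (Fin d → ℝ) → ℝ) : (Fin d → ℝ) → ℝ :=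
  (List.finRange d).foldr (fun i g => (partialDeriv i)^[α i] g) f

/-- The trifling region `Ω([0,1]ᵈ, K, δ)`: points of the cube with some coordinate in
`⋃_{k=1}^{K-1} (k/K - δ, k/K)`. -/
def triflingRegion (d K : ℕ) (δ : ℝ) : Set (Fin d → ℝ) :=
  ⋃ i : Fin d, {x | x ∈ cube d ∧
    ∃ k : ℕ, 1 ≤ k ∧ k < K ∧ x i ∈ Ioo ((k : ℝ) / K - δ) ((k : ℝ) / K)}

/-- The number of subdivisions per coordinate, `K = ⌊N^{1/d}⌋² ⌊L^{2/d}⌋`. -/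
noncomputable def gridSize (d N L : ℕ) : ℕ :=
  ⌊(N : ℝ) ^ ((1 : ℝ) / d)⌋₊ ^ 2 * ⌊(L : ℝ) ^ ((2 : ℝ) / d)⌋₊

end ReLUApprox

/-! Cut the cube into `K ^ d` cells. A Taylor polynomial of degree below `s` at the lower-left
corner of a cell misses `f` by at most `(s+1)^d K^{-s}` on that cell, so it suffices to compute, up
to errors of order `K^{-s}` per monomial, the cell, its at most `s^d` Taylor coefficients, and the
monomials in the offset from the corner.

Cells: outside the trifling region the coordinates keep a distance from the jumps of the cell index,
so this step function agrees there with a continuous piecewise linear one. Finding two digits in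
turn identifies one of `(NL)^2` integers with width `O(N)` and depth `O(L)` (`Reach.round`).

Coefficients: `K ^ d ≤ (NL)^2` cells each need a number with `J` digits in base `2N`. In
`Reach.point_fit` the cell number splits into a block out of `NL`, a register out of `N` and a
position out of `L`; each register packs `L` values into one large integer, from which the wanted
value is extracted digit by digit. This makes `(NL)^2` values affordable.

Monomials: `u(1-u)` minus its chord interpolant on `n` pieces is a copy of itself shrunk by `n^2`,
composed with a zigzag. After `m` layers the error is `n^{-2m}`; polarization turns squares into
products.

With `J = 2s(⌊log₂ L⌋ + 1)` one has `(2N)^J ≥ K^s`, so quantization and multiplication cost no more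
than the Taylor error. All terms run in parallel (`Reach.taylor_fit`), and `K ≥ N^{2/d} L^{2/d} / 8`
converts `K^{-s}` into the stated rate. -/

namespace ReLUApprox

/-! ### Networks as a calculus of sets of functions on a common domain -/

section Reach

variable {X : Type*}

/-- The affine combinations of a set of functions. -/
def affSpan (T : Set (X → ℝ)) : Submodule ℝ (X → ℝ) :=
  Submodule.span ℝ (insert (fun _ => 1) T)

/-- The rectified linear unit applied to a function. -/
def reluFun (g : X → ℝ) : X → ℝ := fun x => max 0 (g x)

/-- `Reach w T l T'`: starting from the functions in `T`, a network with `l` hidden layers of at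
most `w` nodes each computes every function in `T'`. -/
inductive Reach (w : ℕ) : Set (X → ℝ) → ℕ → Set (X → ℝ) → Prop
  | affine {T T' : Set (X → ℝ)} (h : T' ⊆ affSpan T) : Reach w T 0 T'
  | layer {T G T' : Set (X → ℝ)} {l : ℕ} (hG : G ⊆ affSpan T) (hw : G.encard ≤ w)
      (h : Reach w (reluFun '' G) l T') : Reach w T (l + 1) T'

theorem subset_affSpan {T : Set (X → ℝ)} : T ⊆ affSpan T :=
  (subset_insert _ _).trans Submodule.subset_span

theorem mem_affSpan {T : Set (X → ℝ)} {f : X → ℝ} (h : f ∈ T) : f ∈ affSpan T :=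
  subset_affSpan h

theorem affSpan_le {T T' : Set (X → ℝ)} (h : T ⊆ affSpan T') : affSpan T ≤ affSpan T' := by
  refine Submodule.span_le.2 (insert_subset ?_ h)
  exact Submodule.subset_span (mem_insert _ _)

theorem affSpan_mono {T T' : Set (X → ℝ)} (h : T ⊆ T') : affSpan T ≤ affSpan T' :=
  affSpan_le (h.trans subset_affSpan)

theorem affSpan_const {T : Set (X → ℝ)} (c : ℝ) : (fun _ => c) ∈ affSpan T := by
  have h : (fun _ : X => (1 : ℝ)) ∈ affSpan T := Submodule.subset_span (mem_insert _ _)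
  have := (affSpan T).smul_mem c h
  convert this using 1
  ext x
  simp

theorem affSpan_add {T : Set (X → ℝ)} {f g : X → ℝ} (hf : f ∈ affSpan T) (hg : g ∈ affSpan T) :
    (fun x => f x + g x) ∈ affSpan T := (affSpan T).add_mem hf hg

theorem affSpan_sub {T : Set (X → ℝ)} {f g : X → ℝ} (hf : f ∈ affSpan T) (hg : g ∈ affSpan T) :
    (fun x => f x - g x) ∈ affSpan T := (affSpan T).sub_mem hf hg

theorem affSpan_neg {T : Set (X → ℝ)} {f : X → ℝ} (hf : f ∈ affSpan T) :
    (fun x => - f x) ∈ affSpan T := (affSpan T).neg_mem hf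

theorem affSpan_mul {T : Set (X → ℝ)} {f : X → ℝ} (c : ℝ) (hf : f ∈ affSpan T) :
    (fun x => c * f x) ∈ affSpan T := (affSpan T).smul_mem c hf

theorem affSpan_sum {T : Set (X → ℝ)} {ι : Type*} (s : Finset ι) {f : ι → X → ℝ}
    (hf : ∀ i ∈ s, f i ∈ affSpan T) : (fun x => ∑ i ∈ s, f i x) ∈ affSpan T := by
  have := (affSpan T).sum_mem hf
  convert this using 1
  ext x
  simp

theorem affSpan_congr {T : Set (X → ℝ)} {f : X → ℝ} (g : X → ℝ) (hg : g ∈ affSpan T)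
    (h : ∀ x, f x = g x) : f ∈ affSpan T := by
  rwa [show f = g from funext h]

namespace Reach

variable {w w' l l' : ℕ} {T T' T'' T₁ T₂ T₁' T₂' : Set (X → ℝ)}

theorem mono (h : Reach w T l T') (hw : w ≤ w') : Reach w' T l T' := by
  induction h with
  | affine h => exact .affine h
  | layer hG hw' _ ih => exact .layer hG (hw'.trans (by exact_mod_cast hw)) ih

theorem source (h : Reach w T l T') (hT : T ⊆ affSpan T'') : Reach w T'' l T' := by
  cases h with
  | affine h => exact .affine (h.trans (affSpan_le hT))
  | layer hG hw h => exact .layer (hG.trans (affSpan_le hT)) hw h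

theorem target (h : Reach w T l T') (hT : T'' ⊆ affSpan T') : Reach w T l T'' := by
  induction h with
  | affine h => exact .affine (hT.trans (affSpan_le h))
  | layer hG hw _ ih => exact .layer hG hw (ih hT)

theorem trans (h : Reach w T l T') (h' : Reach w T' l' T'') : Reach w T (l + l') T'' := by
  induction h with
  | affine h => rw [zero_add]; exact h'.source h
  | layer hG hw _ ih =>
    rw [add_right_comm]
    exact .layer hG hw (ih h')

theorem single {G : Set (X → ℝ)} (hG : G ⊆ affSpan T) (hw : G.encard ≤ w)
    (h : T' ⊆ affSpan (reluFun '' G)) : Reach w T 1 T' :=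
  .layer hG hw (.affine h)

theorem union (h₁ : Reach w T₁ l T₁') (h₂ : Reach w' T₂ l T₂') :
    Reach (w + w') (T₁ ∪ T₂) l (T₁' ∪ T₂') := by
  induction h₁ generalizing T₂ with
  | affine h =>
    cases h₂ with
    | affine h' =>
      exact .affine (union_subset (h.trans (affSpan_mono subset_union_left))
        (h'.trans (affSpan_mono subset_union_right)))
  | layer hG hw _ ih =>
    cases h₂ with
    | layer hG' hw' h' =>
      refine .layer (union_subset (hG.trans (affSpan_mono subset_union_left))
        (hG'.trans (affSpan_mono subset_union_right))) ((encard_union_le _ _).trans ?_) ?_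
      · push_cast
        exact add_le_add hw hw'
      · rw [image_union]
        exact ih h'

theorem par (h₁ : Reach w T l T₁') (h₂ : Reach w' T l T₂') :
    Reach (w + w') T l (T₁' ∪ T₂') := by
  simpa using h₁.union h₂

/-- Since `f = σ(f) - σ(-f)`, passing a function unchanged through a layer costs two nodes. This is
the source of the factors 2 in later widths. -/
theorem mem_relu_pair (f : X → ℝ) : f ∈ affSpan (reluFun '' {f, fun x => - f x}) := by
  refine affSpan_congr (fun x => reluFun f x - reluFun (fun x => - f x) x)
    (affSpan_sub (mem_affSpan ⟨f, by simp, rfl⟩) (mem_affSpan ⟨_, by simp, rfl⟩)) fun x => ?_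
  simp only [reluFun]
  rcases le_total 0 (f x) with h | h
  · rw [max_eq_right h, max_eq_left (by linarith)]; ring
  · rw [max_eq_left h, max_eq_right (by linarith)]; ring

theorem carry_one {n : ℕ} (hT : T.encard ≤ n) : Reach (2 * n) T 1 T := by
  refine single (G := T ∪ (fun f : X → ℝ => fun x => - f x) '' T) ?_ ?_ ?_
  · refine union_subset subset_affSpan ?_
    rintro _ ⟨f, hf, rfl⟩
    exact affSpan_neg (mem_affSpan hf)
  · refine (encard_union_le _ _).trans ?_
    push_cast
    rw [two_mul]
    exact add_le_add hT ((encard_image_le _ _).trans hT)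
  · intro f hf
    refine affSpan_mono (image_mono ?_) (mem_relu_pair f)
    rintro _ (rfl | rfl)
    · exact Or.inl hf
    · exact Or.inr ⟨f, hf, rfl⟩

theorem carry {n : ℕ} (hT : T.encard ≤ n) (l : ℕ) : Reach (2 * n) T l T := by
  induction l with
  | zero => exact .affine subset_affSpan
  | succ l ih => exact ih.trans (carry_one hT)

theorem biUnion {ι : Type*} (s : Finset ι) {F : ι → Set (X → ℝ)}
    (h : ∀ i ∈ s, Reach w T l (F i)) : Reach (s.card * w) T l (⋃ i ∈ s, F i) := by
  classical
  induction s using Finset.induction_on with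
  | empty =>
    have : Reach (2 * 0) (∅ : Set (X → ℝ)) l ∅ := carry (by simp) l
    simpa using this.source (empty_subset _)
  | insert a s ha ih =>
    rw [Finset.card_insert_of_notMem ha, Finset.set_biUnion_insert, add_mul, one_mul, add_comm]
    exact (h a (by simp)).par (ih fun i hi => h i (by simp [hi]))

end Reach

theorem exists_linear_of_mem_affSpan {n : ℕ} (g : Fin n → X → ℝ) {f : X → ℝ}
    (hf : f ∈ affSpan (range g)) :
    ∃ (a : Fin n → ℝ) (b : ℝ), ∀ x, f x = ∑ i, a i * g i x + b := by
  rw [affSpan, Submodule.mem_span_insert] at hf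
  obtain ⟨b, z, hz, rfl⟩ := hf
  obtain ⟨a, rfl⟩ := (Submodule.mem_span_range_iff_exists_fun ℝ).1 hz
  refine ⟨a, b, fun x => ?_⟩
  simp [add_comm]

/-- The return to actual networks: enumerating the finite set `G` of a layer gives its nodes, and
affine combinations give its weights. The number of inputs varies in the induction because the nodes
of one layer are the inputs of the next. The functions may live on a subset of `ℝⁿ` while the
network is defined everywhere. -/
theorem Reach.exists_net {w l n : ℕ} {T T' : Set (X → ℝ)} (h : Reach w T l T')
    (g : Fin n → X → ℝ) (hT : T = range g) {f : X → ℝ} (hf : f ∈ T') :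
    ∃ net : Net 1 n, net.width ≤ w ∧ net.depth = l ∧ ∀ x, f x = net.eval (fun i => g i x) 0 := by
  induction h generalizing n with
  | affine h =>
    subst hT
    obtain ⟨a, b, hab⟩ := exists_linear_of_mem_affSpan g (h hf)
    refine ⟨.output (Matrix.of fun _ => a) (fun _ => b), by simp [Net.width], by simp [Net.depth],
      fun x => ?_⟩
    simp [Net.eval, hab, Matrix.mulVec, dotProduct]
  | @layer T G T' l hG hw _ ih =>
    subst hT
    have hfin : G.Finite := finite_of_encard_le_coe hw
    have : Finite G := hfin
    obtain ⟨k, ⟨e⟩⟩ := Finite.exists_equiv_fin G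
    have hk : k ≤ w := by
      have h1 : G.encard = k := by
        rw [← hfin.cast_ncard_eq, ← Nat.card_coe_set_eq, Nat.card_congr e, Nat.card_fin]
      rw [h1] at hw
      exact_mod_cast hw
    choose a b hab using fun i : Fin k =>
      exists_linear_of_mem_affSpan g (hG (e.symm i).2)
    obtain ⟨net, h1, h2, h3⟩ := ih (fun i : Fin k => reluFun (e.symm i : X → ℝ)) (by
      ext u
      constructor
      · rintro ⟨v, hv, rfl⟩
        exact ⟨e ⟨v, hv⟩, by simp⟩
      · rintro ⟨i, rfl⟩
        exact ⟨_, (e.symm i).2, rfl⟩) hf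
    refine ⟨.hidden (Matrix.of a) b net, by simp [Net.width, hk, h1], by simp [Net.depth, h2],
      fun x => ?_⟩
    rw [h3, Net.eval]
    congr 2
    ext i
    simp [relu, reluFun, hab, Matrix.mulVec, dotProduct]

end Reach

/-! ### Step functions and exact recovery of integers -/

section Table

variable {X : Type*}

/-- `y` lies above the integer-valued function `k`, and below `k + 1` by a margin `η`. -/
def Near (k : X → ℕ) (y : X → ℝ) (η : ℝ) : Prop :=
  ∀ x, (k x : ℝ) ≤ y x ∧ y x ≤ k x + 1 - η

theorem near_cast (k : X → ℕ) : Near k (fun x => (k x : ℝ)) 1 := fun x => by simp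

/-- A ramp of slope `η⁻¹` rises from 0 to 1 inside the gap of width `η` that `y` never enters just
below the integer `c`; on the values taken it is an exact indicator. -/
theorem reach_indicator {k : X → ℕ} {y : X → ℝ} {η : ℝ} (hη : 0 < η) (h : Near k y η) (c : ℕ) :
    Reach 2 {y} 1 {fun x => if c ≤ k x then (1 : ℝ) else 0} := by
  have hy : y ∈ affSpan {y} := mem_affSpan rfl
  refine Reach.single
    (G := {fun x => η⁻¹ * (y x - c) + 1, fun x => η⁻¹ * (y x - c)}) ?_ ?_ ?_
  · have h1 := affSpan_mul η⁻¹ (affSpan_sub hy (affSpan_const (c : ℝ)))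
    rintro _ (rfl | rfl)
    · exact affSpan_add h1 (affSpan_const 1)
    · exact h1
  · exact (encard_insert_le _ _).trans (by rw [encard_singleton]; norm_num)
  · rintro _ rfl
    refine affSpan_congr _ (affSpan_sub (mem_affSpan ⟨_, Or.inl rfl, rfl⟩)
      (mem_affSpan ⟨_, Or.inr rfl, rfl⟩)) fun x => ?_
    obtain ⟨h1, h2⟩ := h x
    simp only [reluFun]
    split_ifs with hc
    · have hc' : (c : ℝ) ≤ k x := by exact_mod_cast hc
      have : 0 ≤ η⁻¹ * (y x - c) := mul_nonneg (by positivity) (by linarith)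
      rw [max_eq_right this, max_eq_right (by linarith)]
      ring
    · have hc' : (k x : ℝ) + 1 ≤ c := by exact_mod_cast not_le.1 hc
      have : η⁻¹ * (y x - c) + 1 ≤ 0 := by
        have h3 : y x - c ≤ -η := by linarith
        have := mul_le_mul_of_nonneg_left h3 (inv_nonneg.2 hη.le)
        rw [mul_neg, inv_mul_cancel₀ hη.ne'] at this
        linarith
      rw [max_eq_left this, max_eq_left (by linarith)]
      ring

theorem min_add_telescope (Φ : ℕ → ℝ) (q a n : ℕ) :
    Φ (min q (a + n)) = Φ (min q a) +
      ∑ j ∈ Finset.range n, (Φ (a + j + 1) - Φ (a + j)) * (if a + j + 1 ≤ q then 1 else 0) := by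
  induction n with
  | zero => simp
  | succ n ih =>
    rw [Finset.sum_range_succ, ← add_assoc (Φ (min q a)), ← ih, ← add_assoc a]
    split_ifs with h
    · rw [min_eq_right (by omega), min_eq_right (show a + n ≤ q by omega)]
      ring
    · rw [min_eq_left (show q ≤ a + n + 1 by omega), min_eq_left (show q ≤ a + n by omega)]
      ring

/-- Each layer tests `n` further thresholds and adds the corresponding jumps of `Φ` to the carried
registers, so `r` layers handle `n * r` jumps. All functions `Φ a` share the same indicators, hence
an extra table costs only two nodes. -/
theorem Reach.table_min {A : Type*} [Fintype A] {k : X → ℕ} {y : X → ℝ} {η : ℝ} (hη : 0 < η)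
    (h : Near k y η) {M : ℕ} (hM : 0 < M) (Φ : A → ℕ → ℝ) (n r : ℕ) :
    Reach (2 * n + 2 * (Fintype.card A + 1)) {y} r
      (insert y (range fun a x => Φ a (min (k x / M) (n * r)))) := by
  induction r with
  | zero =>
    refine .affine (insert_subset (mem_affSpan rfl) ?_)
    rintro _ ⟨a, rfl⟩
    simpa using affSpan_const (Φ a 0)
  | succ r ih =>
    refine ih.trans ?_
    set T : Set (X → ℝ) := insert y (range fun a x => Φ a (min (k x / M) (n * r))) with hT
    have hyT : y ∈ T := mem_insert _ _
    have h1 : Reach (2 * (Fintype.card A + 1)) T 1 T := by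
      refine Reach.carry_one ((encard_insert_le _ _).trans ?_)
      push_cast
      gcongr
      rw [← image_univ]
      refine (encard_image_le _ _).trans ?_
      rw [encard_univ, ENat.card_eq_coe_fintype_card]
    have h2 := Reach.biUnion (w := 2) (T := T) (l := 1) (Finset.range n)
      (F := fun j => {fun x => if (n * r + j + 1) * M ≤ k x then (1 : ℝ) else 0})
      (fun j _ => (reach_indicator hη h _).source (by
        rintro _ rfl; exact mem_affSpan hyT))
    have h3 := (h2.par h1).mono (w' := 2 * n + 2 * (Fintype.card A + 1)) (by simp; omega)
    refine h3.target (insert_subset (mem_affSpan (Or.inr hyT)) ?_)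
    rintro _ ⟨a, rfl⟩
    refine affSpan_congr _ (affSpan_add (mem_affSpan (Or.inr (Or.inr ⟨a, rfl⟩)))
      (affSpan_sum (Finset.range n) fun j hj =>
        affSpan_mul (Φ a (n * r + j + 1) - Φ a (n * r + j))
          (mem_affSpan (Or.inl (mem_biUnion hj rfl))))) fun x => ?_
    simp only [← Nat.le_div_iff_mul_le hM]
    rw [mul_add, mul_one, min_add_telescope (Φ a)]

/-- Tabulated functions of the quotient `k / M`. -/
theorem Reach.table {A : Type*} [Fintype A] {k : X → ℕ} {y : X → ℝ} {η : ℝ} (hη : 0 < η)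
    (h : Near k y η) {M : ℕ} (hM : 0 < M) (Φ : A → ℕ → ℝ) {n r : ℕ}
    (hk : ∀ x, k x < M * (n * r + 1)) :
    Reach (2 * n + 2 * (Fintype.card A + 1)) {y} r
      (insert y (range fun a x => Φ a (k x / M))) := by
  convert Reach.table_min hη h hM Φ n r using 6 with a x
  rw [min_eq_left]
  have := Nat.div_lt_of_lt_mul (hk x)
  omega

theorem Reach.quotient {k : X → ℕ} {y : X → ℝ} {η : ℝ} (hη : 0 < η)
    (h : Near k y η) {M : ℕ} (hM : 0 < M) {n r : ℕ} (hk : ∀ x, k x < M * (n * r + 1)) :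
    Reach (2 * n + 4) {y} r {y, fun x => ((k x / M : ℕ) : ℝ)} := by
  have := Reach.table (A := Unit) hη h hM (fun _ j => (j : ℝ)) hk
  rw [range_const] at this
  exact this.mono (by simp)

theorem Near.sub_mul_div {k : X → ℕ} {y : X → ℝ} {η : ℝ} (h : Near k y η) (M : ℕ) :
    Near (fun x => k x % M) (fun x => y x - M * ((k x / M : ℕ) : ℝ)) η := by
  intro x
  have : (k x : ℝ) = M * ((k x / M : ℕ) : ℝ) + ((k x % M : ℕ) : ℝ) := by
    exact_mod_cast (Nat.div_add_mod (k x) M).symm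
  obtain ⟨h1, h2⟩ := h x
  constructor <;> linarith

theorem cast_mod_eq (k M : ℕ) : ((k % M : ℕ) : ℝ) = k - M * ((k / M : ℕ) : ℝ) := by
  have : (k : ℝ) = M * ((k / M : ℕ) : ℝ) + ((k % M : ℕ) : ℝ) := by
    exact_mod_cast (Nat.div_add_mod k M).symm
  linarith

/-- Recovering an integer with two digits from an approximation. -/
theorem Reach.round {k : X → ℕ} {y : X → ℝ} {η : ℝ} (hη : 0 < η) (h : Near k y η) {n r : ℕ}
    (hn : 0 < n) (hr : 0 < r) (hk : ∀ x, k x < (n * r) * (n * r)) :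
    Reach (2 * n + 6) {y} (r + r) {fun x => (k x : ℝ)} := by
  have hM : 0 < n * r := by positivity
  have h1 := Reach.quotient hη h hM (n := n) (r := r)
    (fun x => (hk x).trans_le (Nat.mul_le_mul_left _ (by omega)))
  -- Subtracting the high digit leaves an approximation of the low digit with the same margin, so
  -- the same search applies again. With divisor 1 the quotient is the low digit itself.
  have h2 := Reach.quotient hη (h.sub_mul_div (n * r)) one_pos (n := n) (r := r)
    (fun x => by have := Nat.mod_lt (k x) hM; omega)
  set u : X → ℝ := fun x => ((k x / (n * r) : ℕ) : ℝ)
  have h3 : Reach (2 * n + 6) {y, u} r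
      ({u} ∪ {fun x => y x - (n * r : ℕ) * u x, fun x => ((k x % (n * r) / 1 : ℕ) : ℝ)}) := by
    refine (((Reach.carry (n := 1) (T := {u}) (by simp) r).source ?_).par (h2.source ?_)).mono
      (by omega)
    · rintro _ rfl; exact mem_affSpan (by simp)
    · rintro _ rfl
      exact affSpan_sub (mem_affSpan (by simp)) (affSpan_mul _ (mem_affSpan (Or.inr rfl)))
  refine ((h1.mono (by omega)).trans h3).target ?_
  rintro _ rfl
  refine affSpan_congr _ (affSpan_add (affSpan_mul ((n * r : ℕ) : ℝ) (mem_affSpan (Or.inl rfl)))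
    (mem_affSpan (Or.inr (Or.inr rfl)))) fun x => ?_
  simp only [u, Nat.div_one, cast_mod_eq]
  ring

end Table

/-! ### Fitting `(N * L) ^ 2` values by packing and extracting digits -/

section PointFit

variable {X : Type*}

/-- Each layer finds and removes the leading digit in base `B` with `B - 1` thresholds. Thus a
quotient with `B ^ J` possible values takes `J` layers instead of `B ^ J` thresholds. -/
theorem Reach.mod {B : ℕ} (hB : 0 < B) {M : ℕ} (hM : 0 < M) (J : ℕ) {a : X → ℕ}
    (ha : ∀ x, a x < B ^ J * M) :
    Reach (2 * B + 2) {fun x => (a x : ℝ)} J {fun x => ((a x % M : ℕ) : ℝ)} := by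
  induction J generalizing a with
  | zero =>
    refine .affine ?_
    rintro _ rfl
    refine affSpan_congr _ (mem_affSpan rfl) fun x => ?_
    rw [Nat.mod_eq_of_lt (by simpa using ha x)]
  | succ J ih =>
    have h1 := Reach.quotient one_pos (near_cast a) (M := B ^ J * M) (n := B - 1) (r := 1)
      (by positivity) (fun x => (ha x).trans_eq (by
        rw [mul_one, Nat.sub_add_cancel hB]; ring))
    have h2 := ih (a := fun x => a x % (B ^ J * M)) fun x => Nat.mod_lt _ (by positivity)
    rw [add_comm J]
    refine (h1.mono (by omega)).trans ((h2.source ?_).target ?_)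
    · rintro _ rfl
      exact affSpan_congr _ (affSpan_sub (mem_affSpan (Or.inl rfl))
        (affSpan_mul ((B ^ J * M : ℕ) : ℝ) (mem_affSpan (Or.inr rfl)))) fun x => cast_mod_eq _ _
    · rintro _ rfl
      refine affSpan_congr _ (mem_affSpan rfl) fun x => ?_
      rw [Nat.mod_mod_of_dvd _ (Dvd.intro_left _ rfl)]

theorem Reach.abs_sub (ℓ : X → ℝ) (c : ℝ) : Reach 2 {ℓ} 1 {fun x => |ℓ x - c|} := by
  refine Reach.single (G := {fun x => ℓ x - c, fun x => c - ℓ x}) ?_ ?_ ?_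
  · rintro _ (rfl | rfl)
    · exact affSpan_sub (mem_affSpan rfl) (affSpan_const c)
    · exact affSpan_sub (affSpan_const c) (mem_affSpan rfl)
  · exact (encard_insert_le _ _).trans (by rw [encard_singleton]; norm_num)
  · rintro _ rfl
    refine affSpan_congr _ (affSpan_add (mem_affSpan ⟨_, Or.inl rfl, rfl⟩)
      (mem_affSpan ⟨_, Or.inr rfl, rfl⟩)) fun x => ?_
    simp only [reluFun]
    rcases le_total c (ℓ x) with h | h
    · rw [abs_of_nonneg (by linarith), max_eq_right (by linarith), max_eq_left (by linarith)]
      ring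
    · rw [abs_of_nonpos (by linarith), max_eq_left (by linarith), max_eq_right (by linarith)]
      ring

/-- The single node `σ(w - C|ℓ - j|)` suffices: distinct integers differ by at least 1, so the
penalty is at least `C ≥ w`. -/
theorem Reach.gate {w : X → ℝ} {C : ℝ} (hw : ∀ x, 0 ≤ w x ∧ w x ≤ C) (ℓ : X → ℕ) (j : ℕ) :
    Reach 1 {w, fun x => |(ℓ x : ℝ) - j|} 1 {fun x => if ℓ x = j then w x else 0} := by
  refine Reach.single (G := {fun x => w x - C * |(ℓ x : ℝ) - j|}) ?_ (by simp) ?_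
  · rintro _ rfl
    exact affSpan_sub (mem_affSpan (Or.inl rfl)) (affSpan_mul C (mem_affSpan (Or.inr rfl)))
  · rintro _ rfl
    refine affSpan_congr _ (mem_affSpan ⟨_, rfl, rfl⟩) fun x => ?_
    obtain ⟨h0, h1⟩ := hw x
    simp only [reluFun]
    split_ifs with h
    · rw [h, sub_self, abs_zero, mul_zero, sub_zero, max_eq_right h0]
    · have h2 : (1 : ℝ) ≤ |(ℓ x : ℝ) - j| := by
        have : (1 : ℤ) ≤ |(ℓ x : ℤ) - j| := Int.one_le_abs (by omega)
        exact_mod_cast this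
      rw [max_eq_left]
      nlinarith

/-- Reading off the digit of `a` in base `B ^ J` at the variable position `ℓ`. -/
theorem Reach.read_digit {B : ℕ} (hB : 0 < B) (J L : ℕ) {a : X → ℕ}
    (ha : ∀ x, a x < (B ^ J) ^ L) (ℓ : X → ℕ) (out : X → ℝ) :
    Reach (2 * B + 10) {fun x => (a x : ℝ), fun x => (ℓ x : ℝ), out} (L * (J + 2))
      {fun x => out x + if ℓ x < L then ((a x / (B ^ J) ^ ℓ x % B ^ J : ℕ) : ℝ) else 0} := by
  induction L generalizing a out with
  | zero =>
    rw [zero_mul]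
    refine .affine ?_
    rintro _ rfl
    exact affSpan_congr out (mem_affSpan (by simp)) fun x => by simp
  | succ L ih =>
    have hD : 0 < (B ^ J) ^ L := by positivity
    set A : X → ℝ := fun x => (a x : ℝ) with hA
    set l : X → ℝ := fun x => (ℓ x : ℝ) with hl
    set a' : X → ℕ := fun x => a x % (B ^ J) ^ L with ha'
    set w : X → ℝ := fun x => ((a x / (B ^ J) ^ L : ℕ) : ℝ) with hw
    set A' : X → ℝ := fun x => (a' x : ℝ) with hA'
    have h1 := Reach.mod hB hD J (a := a) (fun x => (ha x).trans_eq (by ring))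
    have h2 : Reach (2 * B + 10) {A, l, out} J ({A'} ∪ {A, l, out}) := by
      refine ((h1.source ?_).par (Reach.carry (n := 3) ?_ J)).mono (by omega)
      · rintro _ rfl; exact mem_affSpan (Or.inl rfl)
      · exact encard_insert_le _ _ |>.trans (by
          grw [encard_insert_le, encard_singleton]; norm_num)
    have hA2 : ∀ x, A' x = A x - ((B ^ J) ^ L : ℕ) * w x := fun x => cast_mod_eq _ _
    have h3 : Reach (2 * B + 10) {A', w, l, out} 1
        ({fun x => |l x - (L : ℝ)|} ∪ {A', w, l, out}) := by
      refine (((Reach.abs_sub l L).source ?_).par (Reach.carry (n := 4) ?_ 1)).mono (by omega)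
      · rintro _ rfl; exact mem_affSpan (by simp)
      · grw [encard_insert_le, encard_insert_le, encard_insert_le, encard_singleton]; norm_num
    have h4 : Reach (2 * B + 10) ({fun x => |l x - (L : ℝ)|} ∪ {A', w, l, out}) 1
        ({fun x => if ℓ x = L then w x else 0} ∪ {A', l, out}) := by
      refine (((Reach.gate (w := w) (C := (B ^ J : ℕ)) ?_ ℓ L).source ?_).par
        ((Reach.carry (n := 3) ?_ 1).source ?_)).mono (by omega)
      · intro x
        refine ⟨by positivity, ?_⟩
        have : a x / (B ^ J) ^ L < B ^ J := Nat.div_lt_of_lt_mul ((ha x).trans_eq (by ring))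
        simp only [hw]
        exact_mod_cast this.le
      · rintro _ (rfl | rfl)
        · exact mem_affSpan (by simp)
        · exact mem_affSpan (Or.inl rfl)
      · grw [encard_insert_le, encard_insert_le, encard_singleton]; norm_num
      · rintro _ (rfl | rfl | rfl) <;> exact mem_affSpan (by simp)
    have h5 := ih (a := a') (fun x => Nat.mod_lt _ hD)
      (fun x => out x + if ℓ x = L then w x else 0)
    have h23 : Reach (2 * B + 10) {A, l, out} J {A', w, l, out} := by
      refine h2.target ?_
      rintro _ (rfl | rfl | rfl | rfl)
      · exact mem_affSpan (by simp)
      -- The top digit is affine in the number and its remainder, so it needs no further nodes.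
      · refine affSpan_congr _ (affSpan_mul (((B ^ J) ^ L : ℕ) : ℝ)⁻¹
          (affSpan_sub (mem_affSpan (T := {A'} ∪ {A, l, out}) (f := A) (by simp))
          (mem_affSpan (f := A') (by simp)))) fun x => ?_
        rw [hA2, sub_sub_cancel, inv_mul_cancel_left₀ (by positivity)]
      · exact mem_affSpan (by simp)
      · exact mem_affSpan (by simp)
    have h6 := ((h23.trans h3).trans h4).trans (h5.source (T'' :=
      {fun x => if ℓ x = L then w x else 0} ∪ {A', l, out}) (by
        rintro _ (rfl | rfl | rfl)
        · exact mem_affSpan (by simp [hA'])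
        · exact mem_affSpan (by simp [hl])
        · exact affSpan_add (mem_affSpan (by simp)) (mem_affSpan (Or.inl rfl))))
    rw [show (L + 1) * (J + 2) = J + 1 + 1 + L * (J + 2) by ring]
    refine h6.target ?_
    rintro _ rfl
    refine affSpan_congr _ (mem_affSpan rfl) fun x => ?_
    rw [add_assoc]
    congr 1
    rcases lt_trichotomy (ℓ x) L with h | h | h
    · rw [if_pos (by omega), if_neg h.ne, if_pos h, zero_add]
      congr 1
      obtain ⟨e, he⟩ : ∃ e, L = ℓ x + (e + 1) := ⟨L - ℓ x - 1, by omega⟩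
      simp only [ha', he]
      rw [pow_add, Nat.mod_mul_right_div_self, Nat.mod_mod_of_dvd _ (dvd_pow_self _ (by omega))]
    · rw [if_pos (by omega), if_pos h, if_neg (by omega), add_zero, h, Nat.mod_eq_of_lt]
      exact Nat.div_lt_of_lt_mul ((ha x).trans_eq (by ring))
    · rw [if_neg (by omega), if_neg (by omega), if_neg (by omega), add_zero]

/-- Selecting one of finitely many bounded registers. -/
theorem Reach.select {N : ℕ} (F : Fin N → X → ℝ) {C : ℝ} (hF : ∀ i x, 0 ≤ F i x ∧ F i x ≤ C)
    (v : X → Fin N) :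
    Reach (4 * N) (insert (fun x => ((v x : ℕ) : ℝ)) (range F)) 2 {fun x => F (v x) x} := by
  set V : X → ℝ := fun x => ((v x : ℕ) : ℝ) with hV
  set E : Fin N → X → ℝ := fun i x => |V x - (i : ℕ)| with hE
  have h1 : Reach (4 * N) (insert V (range F)) 1 ((⋃ i ∈ Finset.univ, {E i}) ∪ range F) := by
    refine ((Reach.biUnion (w := 2) Finset.univ (F := fun i : Fin N => {E i}) fun i _ =>
      (Reach.abs_sub V ((i : ℕ) : ℝ)).source ?_).par
      ((Reach.carry (n := N) ?_ 1).source ?_)).mono (by simp; omega)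
    · rintro _ rfl; exact mem_affSpan (mem_insert _ _)
    · rw [← image_univ]
      refine (encard_image_le _ _).trans ?_
      simp
    · exact (subset_insert _ _).trans subset_affSpan
  have h2 : Reach (4 * N) ((⋃ i ∈ Finset.univ, {E i}) ∪ range F) 1
      (⋃ i ∈ (Finset.univ : Finset (Fin N)), {fun x => if (v x : ℕ) = i then F i x else 0}) := by
    refine (Reach.biUnion (w := 1) Finset.univ
      (F := fun i : Fin N => {fun x => if (v x : ℕ) = i then F i x else 0}) fun i _ =>
      (Reach.gate (hF i) (fun x => (v x : ℕ)) i).source ?_).mono (by simp; omega)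
    rintro _ (rfl | rfl)
    · exact mem_affSpan (Or.inr ⟨i, rfl⟩)
    · exact mem_affSpan (Or.inl (mem_biUnion (Finset.mem_univ i) rfl))
  refine (h1.trans h2).target ?_
  rintro _ rfl
  refine affSpan_congr _ (affSpan_sum Finset.univ fun i hi =>
    mem_affSpan (mem_biUnion hi rfl)) fun x => ?_
  simp [Fin.val_inj]

/-- Fitting arbitrary natural numbers below `B ^ J` at `(N * L) ^ 2` points. -/
theorem Reach.point_fit {N L B : ℕ} (hN : 0 < N) (hL : 0 < L) (hB : 0 < B) (J : ℕ)
    {k : X → ℕ} (hk : ∀ x, k x < (N * L) * (N * L)) (c : ℕ → Fin (B ^ J)) :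
    Reach (4 * N + 2 * B + 10) {fun x => (k x : ℝ)} (2 * L + 3 + L * (J + 2))
      {fun x => ((c (k x) : ℕ) : ℝ)} := by
  set P := N * L with hP
  have hP0 : 0 < P := by positivity
  set u : X → ℕ := fun x => k x / P with hu
  set v : X → ℕ := fun x => k x % P / L with hv
  set ℓ : X → ℕ := fun x => k x % P % L with hl
  have hvN : ∀ x, v x < N := fun x => Nat.div_lt_of_lt_mul (by
    rw [mul_comm]; exact Nat.mod_lt _ hP0)
  have hlL : ∀ x, ℓ x < L := fun x => Nat.mod_lt _ hL
  have hukl : ∀ x, P * u x + (L * v x + ℓ x) = k x := fun x => by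
    rw [hl, hv, hu]; simp only [Nat.div_add_mod]
  have huP : ∀ x, u x < P := fun x => Nat.div_lt_of_lt_mul (hk x)
  -- One integer stores the `L` consecutive values of block `i`, register `j`, as digits in base `B
  -- ^ J`.
  let enc : ℕ → ℕ → ℕ := fun i j =>
    (finFunctionFinEquiv (fun q : Fin L => c (P * i + (L * j + q))) : Fin ((B ^ J) ^ L))
  have hencl : ∀ i j, enc i j < (B ^ J) ^ L := fun i j => Fin.is_lt _
  have henc : ∀ x, enc (u x) (v x) / (B ^ J) ^ ℓ x % B ^ J = c (k x) := fun x => by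
    have := finFunctionFinEquiv_symm_apply_val
      (finFunctionFinEquiv (fun q : Fin L => c (P * u x + (L * v x + q)))) ⟨ℓ x, hlL x⟩
    rw [Equiv.symm_apply_apply] at this
    rw [← this]
    simp only [hukl]
  set kk : X → ℝ := fun x => (k x : ℝ) with hkk
  set uu : X → ℝ := fun x => (u x : ℝ) with huu
  set vv : X → ℝ := fun x => (v x : ℝ) with hvv
  set ll : X → ℝ := fun x => (ℓ x : ℝ) with hll
  set W := 4 * N + 2 * B + 10 with hW
  have h1 : Reach W {kk} L {kk, uu} :=
    (Reach.quotient one_pos (near_cast k) hP0 (n := N) (r := L) fun x =>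
      (hk x).trans_le (Nat.mul_le_mul_left _ (by omega))).mono (by omega)
  set rr : X → ℝ := fun x => ((k x % P : ℕ) : ℝ) with hrr
  have h2 : Reach W {kk, uu} 1 ({uu} ∪ {rr, vv}) := by
    refine (((Reach.carry (n := 1) (T := {uu}) (by simp) 1).source ?_).par
      ((Reach.quotient one_pos (near_cast fun x => k x % P) hL (n := N) (r := 1)
        fun x => ?_).source ?_)).mono (by omega)
    · rintro _ rfl; exact mem_affSpan (Or.inr rfl)
    · have := Nat.mod_lt (k x) hP0
      rw [mul_one]
      refine this.trans_le ?_
      rw [hP, mul_comm]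
      exact Nat.mul_le_mul_left _ (by omega)
    · rintro _ rfl
      exact affSpan_congr _ (affSpan_sub (mem_affSpan (Or.inl rfl))
        (affSpan_mul (P : ℝ) (mem_affSpan (Or.inr rfl)))) fun x => cast_mod_eq _ _
  set F : Fin N → X → ℝ := fun j x => (enc (u x) j : ℝ) with hF
  have h3 : Reach W ({uu} ∪ {rr, vv}) L ({vv, ll} ∪ range F) := by
    have h := Reach.table one_pos (near_cast u) one_pos (fun (j : Fin N) i => (enc i j : ℝ))
      (n := N) (r := L) (fun x => by have := huP x; omega)
    simp only [Nat.div_one] at h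
    refine (((Reach.carry (n := 2) (T := {vv, ll}) ?_ L).source ?_).par
      ((h.target ((subset_insert _ _).trans subset_affSpan)).source ?_)).mono
      (by simp; omega)
    · grw [encard_insert_le, encard_singleton]; norm_num
    · rintro _ (rfl | rfl)
      · exact mem_affSpan (by simp)
      · exact affSpan_congr _ (affSpan_sub (mem_affSpan (f := rr) (by simp))
          (affSpan_mul (L : ℝ) (mem_affSpan (f := vv) (by simp)))) fun x => cast_mod_eq _ _
    · rintro _ rfl; exact mem_affSpan (Or.inl rfl)
  set aa : X → ℝ := fun x => (enc (u x) (v x) : ℝ) with haa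
  have h4 : Reach W ({vv, ll} ∪ range F) 2 ({aa} ∪ {ll}) := by
    refine (((Reach.select F (C := ((B ^ J) ^ L : ℕ)) (fun i x => ⟨by positivity, ?_⟩)
      fun x => ⟨v x, hvN x⟩).source ?_).par
      ((Reach.carry (n := 1) (T := {ll}) (by simp) 2).source ?_)).mono (by omega)
    · simp only [hF]
      exact_mod_cast (hencl (u x) i).le
    · refine insert_subset (mem_affSpan (by simp [hvv])) ?_
      exact subset_union_right.trans subset_affSpan
    · rintro _ rfl; exact mem_affSpan (by simp)
  have h5 := (Reach.read_digit hB J L (a := fun x => enc (u x) (v x)) (fun x => hencl _ _) ℓ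
    (fun _ => 0)).mono (w' := W) (by omega)
  have h6 := (((h1.trans h2).trans h3).trans h4).trans (h5.source (by
    rintro _ (rfl | rfl | rfl)
    · exact mem_affSpan (by simp [haa])
    · exact mem_affSpan (by simp [hll])
    · exact affSpan_const 0))
  -- The layers in order: block number, register number, table of the `N` packed integers, selection
  -- of one register, reading of one digit.
  rw [show 2 * L + 3 + L * (J + 2) = L + 1 + L + 2 + L * (J + 2) by ring]
  refine h6.target ?_
  rintro _ rfl
  refine affSpan_congr _ (mem_affSpan rfl) fun x => ?_
  rw [if_pos (hlL x), zero_add, henc]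

end PointFit

/-! ### Approximate squares, products and monomials -/

section Multiplication

theorem sum_mul_relu_eq (g : ℕ → ℝ) {w : ℝ} {j n : ℕ} (hj : j < n) (h0 : (j : ℝ) ≤ w)
    (h1 : w ≤ j + 1) :
    ∑ i ∈ Finset.range n, g i * max 0 (w - i) = ∑ i ∈ Finset.range (j + 1), g i * (w - i) := by
  rw [← Finset.sum_subset (Finset.range_mono (Nat.succ_le_iff.2 hj))]
  · refine Finset.sum_congr rfl fun i hi => ?_
    have : (i : ℝ) ≤ j := by exact_mod_cast Nat.lt_succ_iff.1 (Finset.mem_range.1 hi)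
    rw [max_eq_right (by linarith)]
  · intro i _ hi
    have : ((j + 1 : ℕ) : ℝ) ≤ i := by exact_mod_cast not_lt.1 (fun h => hi (Finset.mem_range.2 h))
    push_cast at this
    rw [max_eq_left (by linarith), mul_zero]

theorem sum_sub_range (w : ℝ) (j : ℕ) :
    ∑ i ∈ Finset.range (j + 1), (1 : ℝ) * (w - i) = (j + 1) * w - j * (j + 1) / 2 := by
  induction j with
  | zero => simp
  | succ j ih => rw [Finset.sum_range_succ, ih]; push_cast; ring

theorem sum_alternating_sub_range (w : ℝ) (j : ℕ) :
    -w + 2 * ∑ i ∈ Finset.range (j + 1), (-1) ^ i * (w - i) =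
      (-1) ^ j * (w - j - 1 / 2) + 1 / 2 := by
  induction j with
  | zero => simp; ring
  | succ j ih =>
    rw [Finset.sum_range_succ, mul_add, ← add_assoc, ih, pow_succ]
    push_cast
    ring

/-- The continuous zigzag function with `n` linear pieces on `[0, 1]`. -/
def zigzag (n : ℕ) (u : ℝ) : ℝ :=
  -(n * u) + 2 * ∑ i ∈ Finset.range n, (-1) ^ i * max 0 (n * u - i)

/-- The piecewise linear interpolation of `u * (1 - u)` at the multiples of `1 / n`. -/
noncomputable def chord (n : ℕ) (u : ℝ) : ℝ :=
  (1 / n + 1 / n ^ 2) * (n * u) - 2 / n ^ 2 * ∑ i ∈ Finset.range n, 1 * max 0 (n * u - i)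

theorem exists_piece {n : ℕ} (hn : 0 < n) {w : ℝ} (h0 : 0 ≤ w) (h1 : w ≤ n) :
    ∃ j < n, (j : ℝ) ≤ w ∧ w ≤ j + 1 := by
  rcases h1.lt_or_eq with h | h
  · exact ⟨⌊w⌋₊, (Nat.floor_lt h0).2 h, Nat.floor_le h0, (Nat.lt_floor_add_one w).le⟩
  · refine ⟨n - 1, by omega, ?_⟩
    rw [Nat.cast_pred hn]
    constructor <;> linarith

/-- On the piece `[j/n, (j+1)/n]` put `τ = n u - j`. The zigzag is `τ` or `1 - τ`, so its product
with its complement is `τ(1 - τ)` either way, and a parabola exceeds its chord there by exactly `τ(1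
- τ)/n²`. -/
theorem zigzag_spec {n : ℕ} (hn : 0 < n) {u : ℝ} (h0 : 0 ≤ u) (h1 : u ≤ 1) :
    (0 ≤ zigzag n u ∧ zigzag n u ≤ 1) ∧
      u * (1 - u) = chord n u + (zigzag n u * (1 - zigzag n u)) / n ^ 2 := by
  have hn' : (0 : ℝ) < n := by exact_mod_cast hn
  obtain ⟨j, hj, hj0, hj1⟩ := exists_piece hn (w := n * u) (by positivity)
    (mul_le_of_le_one_right hn'.le h1)
  have hz : zigzag n u = (-1) ^ j * (n * u - j - 1 / 2) + 1 / 2 := by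
    rw [zigzag, sum_mul_relu_eq _ hj hj0 hj1, sum_alternating_sub_range]
  have hc : chord n u = (1 / n + 1 / n ^ 2) * (n * u) -
      2 / n ^ 2 * ((j + 1) * (n * u) - j * (j + 1) / 2) := by
    rw [chord, sum_mul_relu_eq (fun _ => 1) hj hj0 hj1, sum_sub_range]
  have hsq : ((-1 : ℝ) ^ j) ^ 2 = 1 := by rw [← pow_mul, mul_comm, pow_mul]; simp
  constructor
  · rw [hz]
    rcases neg_one_pow_eq_or ℝ j with h | h <;> rw [h] <;> constructor <;> linarith
  · have : zigzag n u * (1 - zigzag n u) = 1 / 4 - (n * u - j - 1 / 2) ^ 2 := by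
      rw [hz]
      linear_combination -(n * u - j - 1 / 2) ^ 2 * hsq
    rw [this, hc]
    field_simp
    ring

variable {X : Type*}

/-- Approximation of `u * (1 - u)`, added to a register with a prescribed factor. -/
theorem Reach.square_fit {n : ℕ} (hn : 0 < n) (m : ℕ) (u acc : X → ℝ) (c : ℝ)
    (hu : ∀ x, 0 ≤ u x ∧ u x ≤ 1) :
    ∃ Q : X → ℝ, (∀ x, |Q x - u x * (1 - u x)| ≤ 1 / ((n : ℝ) ^ 2) ^ m) ∧
      Reach (n + 2) {u, acc} m {fun x => acc x + c * Q x} := by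
  induction m generalizing u acc c with
  | zero =>
    refine ⟨fun _ => 0, fun x => ?_, .affine ?_⟩
    · obtain ⟨h0, h1⟩ := hu x
      rw [abs_le]
      constructor <;> norm_num <;> nlinarith
    · rintro _ rfl
      exact affSpan_congr acc (mem_affSpan (by simp)) fun x => by simp
  | succ m ih =>
    have hn' : (0 : ℝ) < n := by exact_mod_cast hn
    -- Self-similarity: bank the chord in the accumulator now, and treat the zigzag as the new
    -- argument with the factor reduced by `n²`.
    obtain ⟨Q, hQ, hR⟩ := ih (fun x => zigzag n (u x)) (fun x => acc x + c * chord n (u x))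
      (c / n ^ 2) fun x => (zigzag_spec hn (hu x).1 (hu x).2).1
    refine ⟨fun x => chord n (u x) + Q x / n ^ 2, fun x => ?_, ?_⟩
    · rw [(zigzag_spec hn (hu x).1 (hu x).2).2, add_sub_add_left_eq_sub, ← sub_div, abs_div,
        abs_of_pos (by positivity : (0 : ℝ) < (n : ℝ) ^ 2), pow_succ _ m, ← div_div]
      exact div_le_div_of_nonneg_right (hQ x) (by positivity)
    · set R : Fin n → X → ℝ := fun i x => n * u x - (i : ℕ) with hRdef
      have hrelu : Reach n {u, acc} 1 (insert u (range fun i => reluFun (R i))) := by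
        refine Reach.single (G := range R) ?_ ?_ ?_
        · rintro _ ⟨i, rfl⟩
          exact affSpan_sub (affSpan_mul (n : ℝ) (mem_affSpan (by simp))) (affSpan_const _)
        · rw [← image_univ]
          exact (encard_image_le _ _).trans (by simp)
        · refine insert_subset ?_ ?_
          -- As `u ≥ 0`, the node with `i = 0` equals `n u`, so `u` need not be carried separately.
          · refine affSpan_congr _ (affSpan_mul (n : ℝ)⁻¹
              (mem_affSpan ⟨R ⟨0, hn⟩, ⟨_, rfl⟩, rfl⟩)) fun x => ?_
            have : 0 ≤ n * u x := mul_nonneg hn'.le (hu x).1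
            simp only [reluFun, hRdef, Nat.cast_zero, sub_zero]
            rw [max_eq_right this, inv_mul_cancel_left₀ hn'.ne']
          · rintro _ ⟨i, rfl⟩
            exact mem_affSpan ⟨R i, ⟨i, rfl⟩, rfl⟩
      have hstep := hrelu.par ((Reach.carry (n := 1) (T := {acc}) (by simp) 1).source
        (T'' := {u, acc}) (by rintro _ rfl; exact mem_affSpan (by simp)))
      set T : Set (X → ℝ) := (insert u (range fun i => reluFun (R i))) ∪ {acc}
      have hsum : ∀ g : ℕ → ℝ, (fun x => ∑ i ∈ Finset.range n, g i * max 0 (n * u x - i)) ∈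
          affSpan T := fun g => by
        refine affSpan_sum _ fun i hi => affSpan_mul (g i) (mem_affSpan ?_)
        exact Or.inl (Or.inr ⟨⟨i, Finset.mem_range.1 hi⟩, rfl⟩)
      have huT : u ∈ affSpan T := mem_affSpan (Or.inl (Or.inl rfl))
      rw [add_comm m]
      refine hstep.trans ((hR.source ?_).target ?_)
      · rintro _ (rfl | rfl)
        · exact affSpan_add (affSpan_neg (affSpan_mul _ huT)) (affSpan_mul 2 (hsum _))
        · exact affSpan_add (mem_affSpan (Or.inr rfl)) (affSpan_mul c
            (affSpan_sub (affSpan_mul _ (affSpan_mul _ huT)) (affSpan_mul _ (hsum _))))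
      · rintro _ rfl
        exact affSpan_congr _ (mem_affSpan rfl) fun x => by ring

theorem abs_clamp_sub_le {z p : ℝ} (h0 : 0 ≤ p) (h1 : p ≤ 1) :
    (0 ≤ max 0 z - max 0 (z - 1) ∧ max 0 z - max 0 (z - 1) ≤ 1) ∧
      |max 0 z - max 0 (z - 1) - p| ≤ |z - p| := by
  rcases le_total z 0 with h | h
  · rw [max_eq_left h, max_eq_left (by linarith), abs_of_nonpos (by linarith : z - p ≤ 0),
      abs_of_nonpos (by linarith)]
    norm_num; linarith
  · rcases le_total z 1 with h' | h'
    · rw [max_eq_right h, max_eq_left (by linarith), sub_zero]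
      exact ⟨⟨h, h'⟩, le_rfl⟩
    · rw [max_eq_right h, max_eq_right (by linarith), abs_of_nonneg (by linarith : 0 ≤ z - p),
        abs_of_nonneg (by linarith)]
      norm_num; linarith

/-- Approximate multiplication in `[0, 1]`. -/
theorem Reach.mul_fit {n : ℕ} (hn : 0 < n) (m : ℕ) (f g : X → ℝ)
    (hf : ∀ x, 0 ≤ f x ∧ f x ≤ 1) (hg : ∀ x, 0 ≤ g x ∧ g x ≤ 1) :
    ∃ z : X → ℝ, (∀ x, 0 ≤ z x ∧ z x ≤ 1) ∧
      (∀ x, |z x - f x * g x| ≤ 2 / ((n : ℝ) ^ 2) ^ m) ∧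
      Reach (2 * n + 4) {f, g} (m + 2) {z} := by
  -- Polarization `f g = u² - v²` with `u, v` in `[0, 1]`. Since `u² = u - u(1 - u)`, the squares
  -- come from accumulators `u`, `v` and factor `-1`.
  set u : X → ℝ := fun x => 1 / 2 * (f x + g x) with hu
  set v : X → ℝ := fun x => 1 / 2 * |f x - g x - 0| with hv
  obtain ⟨Q, hQ, hQR⟩ := Reach.square_fit hn m u u (-1) fun x => by
    obtain ⟨h0, h1⟩ := hf x
    obtain ⟨h2, h3⟩ := hg x
    simp only [hu]
    constructor <;> linarith
  obtain ⟨P, hP, hPR⟩ := Reach.square_fit hn m v v (-1) fun x => by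
    obtain ⟨h0, h1⟩ := hf x
    obtain ⟨h2, h3⟩ := hg x
    have : |f x - g x - 0| ≤ 1 := abs_le.2 ⟨by linarith, by linarith⟩
    simp only [hv]
    exact ⟨by positivity, by linarith⟩
  -- Truncation to `[0, 1]` does not increase the error, and lets the result serve as a factor
  -- again.
  have hclamp := fun x => abs_clamp_sub_le (z := (u x + -1 * Q x) - (v x + -1 * P x))
    (mul_nonneg (hf x).1 (hg x).1) (mul_le_one₀ (hf x).2 (hg x).1 (hg x).2)
  refine ⟨fun x => max 0 ((u x + -1 * Q x) - (v x + -1 * P x)) -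
    max 0 ((u x + -1 * Q x) - (v x + -1 * P x) - 1), fun x => (hclamp x).1,
    fun x => (hclamp x).2.trans ?_, ?_⟩
  · have h1 := abs_le.1 (hQ x)
    have h2 := abs_le.1 (hP x)
    have h3 : u x * u x - v x * v x = f x * g x := by
      simp only [hu, hv, sub_zero]
      linear_combination (-1 / 4 : ℝ) * abs_mul_abs_self (f x - g x)
    have h4 : (2 : ℝ) / ((n : ℝ) ^ 2) ^ m = 1 / ((n : ℝ) ^ 2) ^ m + 1 / ((n : ℝ) ^ 2) ^ m := by
      ring
    rw [abs_le, h4]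
    constructor <;> linarith
  · have h1 : Reach (2 * n + 4) {f, g} 1 ({f, g} ∪ {fun x => |f x - g x - 0|}) := by
      refine ((Reach.carry (n := 2) ?_ 1).par ((Reach.abs_sub (fun x => f x - g x) 0).source
        ?_)).mono (by omega)
      · grw [encard_insert_le, encard_singleton]; norm_num
      · rintro _ rfl
        exact affSpan_sub (mem_affSpan (by simp)) (mem_affSpan (by simp))
    have h2 : Reach (2 * n + 4) {u, v} m
        ({fun x => u x + -1 * Q x} ∪ {fun x => v x + -1 * P x}) := by
      refine ((hQR.source ?_).par (hPR.source ?_)).mono (by omega)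
      · rintro _ (rfl | rfl) <;> exact mem_affSpan (Or.inl rfl)
      · rintro _ (rfl | rfl) <;> exact mem_affSpan (Or.inr rfl)
    have h3 : Reach (2 * n + 4) ({fun x => u x + -1 * Q x} ∪ {fun x => v x + -1 * P x}) 1
        {fun x => max 0 ((u x + -1 * Q x) - (v x + -1 * P x)) -
          max 0 ((u x + -1 * Q x) - (v x + -1 * P x) - 1)} := by
      have hd := affSpan_sub (T := {fun x => u x + -1 * Q x} ∪ {fun x => v x + -1 * P x})
        (mem_affSpan (Or.inl rfl)) (mem_affSpan (Or.inr rfl))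
      refine Reach.single (G := {fun x => (u x + -1 * Q x) - (v x + -1 * P x),
        fun x => (u x + -1 * Q x) - (v x + -1 * P x) - 1}) ?_ ?_ ?_
      · rintro _ (rfl | rfl)
        · exact hd
        · exact affSpan_sub hd (affSpan_const 1)
      · grw [encard_insert_le, encard_singleton]
        norm_cast
        omega
      · rintro _ rfl
        exact affSpan_sub (mem_affSpan ⟨_, Or.inl rfl, rfl⟩) (mem_affSpan ⟨_, Or.inr rfl, rfl⟩)
    rw [show m + 2 = 1 + m + 1 by ring]
    refine (h1.trans (h2.source ?_)).trans h3
    rintro _ (rfl | rfl)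
    · exact affSpan_mul _ (affSpan_add (mem_affSpan (by simp)) (mem_affSpan (by simp)))
    · exact affSpan_mul _ (mem_affSpan (Or.inr rfl))

theorem abs_mul_sub_mul_le {p q g z e ε : ℝ} (hg0 : 0 ≤ g) (hg1 : g ≤ 1) (hp : |p - q| ≤ e)
    (hz : |z - p * g| ≤ ε) : |z - q * g| ≤ e + ε := by
  have h1 : |(p - q) * g| ≤ e := by
    rw [abs_mul, abs_of_nonneg hg0]
    exact (mul_le_of_le_one_right (abs_nonneg _) hg1).trans hp
  have h2 : z - q * g = (p - q) * g + (z - p * g) := by ring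
  rw [h2]
  exact (abs_add_le _ _).trans (add_le_add h1 hz)

/-- Approximate products of `r` factors in `[0, 1]`. -/
theorem Reach.prod_fit {n : ℕ} (hn : 0 < n) (m : ℕ) {T : Set (X → ℝ)} {c : ℕ}
    (hT : T.encard ≤ c) (g : ℕ → X → ℝ) (hgT : ∀ i, g i ∈ affSpan T)
    (hg : ∀ i x, 0 ≤ g i x ∧ g i x ≤ 1) (r : ℕ) :
    ∃ p : X → ℝ, (∀ x, 0 ≤ p x ∧ p x ≤ 1) ∧
      (∀ x, |p x - ∏ i ∈ Finset.range r, g i x| ≤ r * (2 / ((n : ℝ) ^ 2) ^ m)) ∧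
      Reach (2 * n + 4 + 2 * c) T (r * (m + 2)) (T ∪ {p}) := by
  induction r with
  | zero =>
    refine ⟨fun _ => 1, fun x => by norm_num, fun x => by simp, ?_⟩
    rw [zero_mul]
    refine .affine (union_subset subset_affSpan ?_)
    rintro _ rfl
    exact affSpan_const 1
  | succ r ih =>
    obtain ⟨p, hp, hpe, hR⟩ := ih
    obtain ⟨z, hz, hze, hzR⟩ := Reach.mul_fit hn m p (g r) hp (hg r)
    refine ⟨z, hz, fun x => ?_, ?_⟩
    · rw [Finset.prod_range_succ]
      push_cast
      rw [add_mul, one_mul]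
      exact abs_mul_sub_mul_le (hg r x).1 (hg r x).2 (hpe x) (hze x)
    · rw [add_mul, one_mul]
      refine hR.trans ((((Reach.carry hT _).source ?_).par (hzR.source ?_)).mono (by omega))
      · exact subset_union_left.trans subset_affSpan
      · rintro _ (rfl | rfl)
        · exact mem_affSpan (Or.inr rfl)
        · exact affSpan_mono subset_union_left (hgT r)

end Multiplication

/-! ### Taylor's formula on the closed cube -/

section Taylor

variable {d : ℕ}

theorem mem_cube {x : Fin d → ℝ} : x ∈ cube d ↔ ∀ i, 0 ≤ x i ∧ x i ≤ 1 :=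
  ⟨fun h i => ⟨h.1 i, h.2 i⟩, fun h => ⟨fun i => (h i).1, fun i => (h i).2⟩⟩

theorem cube_eq_pi : cube d = univ.pi fun _ => Icc (0 : ℝ) 1 := by
  ext x
  rw [mem_cube, mem_univ_pi]
  rfl

theorem uniqueDiffOn_cube : UniqueDiffOn ℝ (cube d) := by
  rw [cube_eq_pi]
  exact UniqueDiffOn.univ_pi fun _ => uniqueDiffOn_Icc_zero_one

theorem cube_subset_closure_interior : cube d ⊆ closure (interior (cube d)) := by
  rw [cube_eq_pi, interior_pi_set finite_univ, closure_pi_set]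
  simp

theorem update_mem_cube {x : Fin d → ℝ} (hx : x ∈ cube d) (i : Fin d) {t : ℝ}
    (ht : t ∈ Icc (0 : ℝ) 1) : Function.update x i t ∈ cube d := by
  rw [mem_cube] at hx ⊢
  intro j
  rcases eq_or_ne j i with rfl | h
  · simpa using ht
  · simpa [h] using hx j

theorem partialDeriv_eq {g : (Fin d → ℝ) → ℝ} (hg : DifferentiableOn ℝ g (cube d)) (i : Fin d)
    {x : Fin d → ℝ} (hx : x ∈ cube d) :
    partialDeriv i g x = fderivWithin ℝ g (cube d) x (Pi.single i 1) := by
  have h := ((hg x hx).hasFDerivWithinAt.hasLineDerivWithinAt (Pi.single i (1 : ℝ)))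
  refine HasDerivWithinAt.derivWithin h ?_
  have h1 : (fun t : ℝ => x + t • (Pi.single i 1 : Fin d → ℝ)) ⁻¹' cube d =
      Icc (-x i) (1 - x i) := by
    ext t
    simp only [mem_preimage, mem_cube, mem_Icc, Pi.add_apply, Pi.smul_apply, smul_eq_mul]
    rw [mem_cube] at hx
    constructor
    · intro h
      have := h i
      simp only [Pi.single_eq_same, mul_one] at this
      constructor <;> linarith
    · rintro ⟨h1, h2⟩ j
      rcases eq_or_ne j i with rfl | hj
      · simp only [Pi.single_eq_same, mul_one]
        constructor <;> linarith
      · simpa [hj] using hx j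
  rw [h1]
  have := mem_cube.1 hx i
  exact uniqueDiffOn_Icc (by linarith) 0 ⟨by linarith, by linarith⟩

theorem contDiffOn_partialDeriv {g : (Fin d → ℝ) → ℝ} {n : ℕ}
    (hg : ContDiffOn ℝ ((n + 1 : ℕ) : ℕ∞) g (cube d)) (i : Fin d) :
    ContDiffOn ℝ (n : ℕ∞) (partialDeriv i g) (cube d) := by
  have h := (hg.fderivWithin uniqueDiffOn_cube (m := (n : ℕ∞)) (by norm_cast)).clm_apply
    (contDiffOn_const (c := (Pi.single i 1 : Fin d → ℝ)))
  exact h.congr fun x hx => partialDeriv_eq (hg.differentiableOn (by simp)) i hx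

theorem contDiffOn_partialDeriv_iterate {g : (Fin d → ℝ) → ℝ} {n k : ℕ}
    (hg : ContDiffOn ℝ ((n + k : ℕ) : ℕ∞) g (cube d)) (i : Fin d) :
    ContDiffOn ℝ (n : ℕ∞) ((partialDeriv i)^[k] g) (cube d) := by
  induction k generalizing g with
  | zero => simpa using hg
  | succ k ih => exact ih (contDiffOn_partialDeriv hg i)

theorem hasDerivWithinAt_update {g : (Fin d → ℝ) → ℝ} (hg : DifferentiableOn ℝ g (cube d))
    {a : Fin d → ℝ} (ha : a ∈ cube d) (i : Fin d) {t : ℝ} (ht : t ∈ Icc (0 : ℝ) 1) :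
    HasDerivWithinAt (fun t => g (Function.update a i t))
      (partialDeriv i g (Function.update a i t)) (Icc 0 1) t := by
  have hm := update_mem_cube ha i ht
  rw [partialDeriv_eq hg i hm]
  exact (hg _ hm).hasFDerivWithinAt.comp_hasDerivWithinAt t
    (hasDerivAt_update a i t).hasDerivWithinAt fun τ hτ => update_mem_cube ha i hτ

/-- Taylor's formula in one coordinate direction. -/
theorem taylor_coordinate {n : ℕ} {g : (Fin d → ℝ) → ℝ} (hg : ContDiffOn ℝ (n : ℕ∞) g (cube d))
    (i : Fin d) (hb : ∀ x ∈ cube d, |(partialDeriv i)^[n] g x| ≤ 1) {a : Fin d → ℝ}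
    (ha : a ∈ cube d) {t : ℝ} (h0 : a i ≤ t) (h1 : t ≤ 1) :
    |g (Function.update a i t) -
      ∑ j ∈ Finset.range n, (partialDeriv i)^[j] g a * ((t - a i) ^ j / j.factorial)| ≤
      (t - a i) ^ n := by
  have ha0 := (mem_cube.1 ha i).1
  induction n generalizing g t with
  | zero =>
    simpa using hb _ (update_mem_cube ha i ⟨ha0.trans h0, h1⟩)
  | succ n ih =>
    have hd := contDiffOn_partialDeriv hg i
    have hsub : Icc (a i) t ⊆ Icc 0 1 := Icc_subset_Icc ha0 h1
    have hder : ∀ τ ∈ Icc (a i) t, HasDerivWithinAt (fun τ => g (Function.update a i τ) -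
        ∑ j ∈ Finset.range (n + 1), (partialDeriv i)^[j] g a * ((τ - a i) ^ j / j.factorial))
        (partialDeriv i g (Function.update a i τ) - ∑ j ∈ Finset.range n,
          (partialDeriv i)^[j] (partialDeriv i g) a * ((τ - a i) ^ j / j.factorial))
        (Icc (a i) t) τ := by
      intro τ hτ
      refine ((hasDerivWithinAt_update (hg.differentiableOn (by simp)) ha i
        (hsub hτ)).mono hsub).sub ?_
      simp only [Finset.sum_range_succ' _ n, pow_zero]
      refine HasDerivWithinAt.add_const _ (HasDerivWithinAt.fun_sum fun j _ => ?_)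
      refine HasDerivWithinAt.const_mul _ ?_
      have h := ((((hasDerivAt_id τ).sub_const (a i)).fun_pow (j + 1)).div_const
        ((j + 1).factorial : ℝ)).hasDerivWithinAt (s := Icc (a i) t)
      refine h.congr_deriv ?_
      simp only [id, Nat.add_sub_cancel, mul_one, Nat.factorial_succ]
      push_cast
      field_simp
    have hle : ∀ τ ∈ Icc (a i) t, ‖partialDeriv i g (Function.update a i τ) -
        ∑ j ∈ Finset.range n,
          (partialDeriv i)^[j] (partialDeriv i g) a * ((τ - a i) ^ j / j.factorial)‖ ≤
        (t - a i) ^ n := by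
      intro τ hτ
      refine (ih hd hb hτ.1 (hτ.2.trans h1)).trans ?_
      exact pow_le_pow_left₀ (by linarith [hτ.1]) (by linarith [hτ.2]) n
    -- The derivative of the remainder of `g` is the remainder of `∂ᵢ g` of one order less, so the
    -- mean value inequality gives one more power of `t - a i`. The remainder vanishes at `a i`.
    have h := (convex_Icc (a i) t).norm_image_sub_le_of_norm_hasDerivWithin_le hder hle
      (left_mem_Icc.2 h0) (right_mem_Icc.2 h0)
    have hz : g (Function.update a i (a i)) - ∑ j ∈ Finset.range (n + 1),
        (partialDeriv i)^[j] g a * ((a i - a i) ^ j / j.factorial) = 0 := by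
      rw [Finset.sum_range_succ']
      simp
    simp only [hz] at h
    rw [sub_zero, Real.norm_eq_abs, Real.norm_eq_abs, abs_of_nonneg (by linarith : 0 ≤ t - a i)] at h
    rw [pow_succ]
    exact h

/-- The mixed partial derivative along a list of coordinates. -/
noncomputable def listDeriv (l : List (Fin d)) (α : Fin d → ℕ) (f : (Fin d → ℝ) → ℝ) :
    (Fin d → ℝ) → ℝ :=
  l.foldr (fun i g => (partialDeriv i)^[α i] g) f

theorem listDeriv_cons (i : Fin d) (l : List (Fin d)) (α : Fin d → ℕ) (f : (Fin d → ℝ) → ℝ) :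
    listDeriv (i :: l) α f = (partialDeriv i)^[α i] (listDeriv l α f) := rfl

theorem listDeriv_congr {l : List (Fin d)} {α β : Fin d → ℕ} (h : ∀ i ∈ l, α i = β i)
    (f : (Fin d → ℝ) → ℝ) : listDeriv l α f = listDeriv l β f := by
  induction l with
  | nil => rfl
  | cons i l ih =>
    rw [listDeriv_cons, listDeriv_cons, h i (by simp), ih fun j hj => h j (by simp [hj])]

theorem listDeriv_append {p l : List (Fin d)} {α : Fin d → ℕ} (h : ∀ i ∈ p, α i = 0)
    (f : (Fin d → ℝ) → ℝ) : listDeriv (p ++ l) α f = listDeriv l α f := by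
  induction p with
  | nil => rfl
  | cons i p ih =>
    rw [List.cons_append, listDeriv_cons, h i (by simp), Function.iterate_zero_apply]
    exact ih fun j hj => h j (by simp [hj])

/-- Suffixes of the coordinate list are the innermost derivatives of `multiDeriv`. Adding
coordinates at the front therefore respects its order of differentiation, and symmetry of mixed
derivatives is never needed. -/
theorem listDeriv_eq_multiDeriv {l : List (Fin d)} (hl : l <:+ List.finRange d) {α : Fin d → ℕ}
    (hα : ∀ i ∉ l, α i = 0) (f : (Fin d → ℝ) → ℝ) : listDeriv l α f = multiDeriv α f := by
  obtain ⟨p, hp⟩ := hl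
  rw [← listDeriv_append (p := p) (l := l) (f := f), hp]
  · rfl
  · intro i hi
    have hnd := List.nodup_finRange d
    rw [← hp] at hnd
    exact hα i fun h => (List.disjoint_of_nodup_append hnd) hi h

theorem contDiffOn_listDeriv {f : (Fin d → ℝ) → ℝ} {l : List (Fin d)} {α : Fin d → ℕ} {n : ℕ}
    (hf : ContDiffOn ℝ ((n + (l.map α).sum : ℕ) : ℕ∞) f (cube d)) :
    ContDiffOn ℝ (n : ℕ∞) (listDeriv l α f) (cube d) := by
  induction l generalizing n with
  | nil => simpa [listDeriv] using hf
  | cons i l ih =>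
    rw [listDeriv_cons]
    refine contDiffOn_partialDeriv_iterate (ih ?_) i
    rwa [List.map_cons, List.sum_cons, ← add_assoc] at hf

theorem sum_map_list {l : List (Fin d)} (hl : l.Nodup) {α : Fin d → ℕ} (hα : ∀ i ∉ l, α i = 0) :
    (l.map α).sum = ∑ i, α i := by
  rw [← List.sum_toFinset _ hl]
  exact Finset.sum_subset (Finset.subset_univ _) fun i _ hi => hα i (by simpa using hi)

/-- The almost everywhere bound says that the continuous functions `max |g| 1` and `1` agree almost
everywhere; they then agree on the whole cube, which lies in the closure of its interior. -/
theorem abs_le_one_of_eLpNorm {g : (Fin d → ℝ) → ℝ} (hg : ContinuousOn g (cube d))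
    (h : eLpNorm g ∞ (volume.restrict (cube d)) ≤ 1) : ∀ x ∈ cube d, |g x| ≤ 1 := by
  have hae : (fun x => max |g x| 1) =ᵐ[volume.restrict (cube d)] fun _ => 1 := by
    filter_upwards [ae_le_eLpNormEssSup (f := g) (μ := volume.restrict (cube d))] with x hx
    rw [eLpNorm_exponent_top] at h
    have h1 := hx.trans h
    rw [max_eq_right]
    rwa [Real.enorm_eq_ofReal_abs, ENNReal.ofReal_le_one] at h1
  have := Measure.eqOn_of_ae_eq hae (hg.abs.sup continuousOn_const) continuousOn_const
    cube_subset_closure_interior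
  intro x hx
  have hx' := this hx
  simp only at hx'
  exact max_eq_right_iff.1 hx'

/-- The multi-indices of order less than `s` that are supported on a list. -/
def indices (s : ℕ) (l : List (Fin d)) : Finset (Fin d → ℕ) :=
  (Fintype.piFinset fun i => if i ∈ l then Finset.range s else {0}).filter
    fun α => ∑ i, α i < s

theorem mem_indices {s : ℕ} {l : List (Fin d)} {α : Fin d → ℕ} :
    α ∈ indices s l ↔ (∀ i ∉ l, α i = 0) ∧ ∑ i, α i < s := by
  rw [indices, Finset.mem_filter, Fintype.mem_piFinset]
  refine and_congr_left fun h => forall_congr' fun i => ?_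
  have : α i ≤ ∑ i, α i := Finset.single_le_sum (fun _ _ => Nat.zero_le _) (Finset.mem_univ i)
  split_ifs with hi
  · simp only [Finset.mem_range, hi, not_true_eq_false, false_imp_iff, iff_true]
    omega
  · simp [hi]

theorem card_indices_le {s : ℕ} {l : List (Fin d)} (hl : l.Nodup) :
    (indices s l).card ≤ s ^ l.length := by
  refine (Finset.card_filter_le _ _).trans ?_
  rw [Fintype.card_piFinset]
  have : ∀ i, (if i ∈ l then Finset.range s else {0}).card = if i ∈ l.toFinset then s else 1 := by
    intro i
    simp only [List.mem_toFinset]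
    split_ifs <;> simp
  rw [Finset.prod_congr rfl fun i _ => this i, Finset.prod_ite_mem, Finset.univ_inter,
    Finset.prod_const, List.toFinset_card_of_nodup hl]

theorem sum_indices_cons {s : ℕ} {i : Fin d} {l : List (Fin d)} (hi : i ∉ l)
    (F : (Fin d → ℕ) → ℝ) :
    ∑ α ∈ indices s (i :: l), F α =
      ∑ β ∈ indices s l, ∑ j ∈ Finset.range (s - ∑ q, β q), F (Function.update β i j) := by
  have hsum : ∀ (β : Fin d → ℕ) j, β i = 0 → ∑ q, Function.update β i j q = j + ∑ q, β q := by
    intro β j hβ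
    rw [Finset.sum_update_of_mem (Finset.mem_univ i),
      Finset.sum_eq_add_sum_sdiff_singleton_of_mem (Finset.mem_univ i) β, hβ, zero_add]
  rw [Finset.sum_sigma']
  refine Finset.sum_bij' (fun α _ => ⟨Function.update α i 0, α i⟩)
    (fun p _ => Function.update p.1 i p.2) ?_ ?_ ?_ ?_ ?_
  · intro α hα
    rw [mem_indices] at hα
    have h := hsum (Function.update α i 0) (α i) (by simp)
    rw [Function.update_idem, Function.update_eq_self] at h
    rw [Finset.mem_sigma, mem_indices, Finset.mem_range]
    refine ⟨⟨fun q hq => ?_, show ∑ q, Function.update α i 0 q < s by omega⟩,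
      show α i < s - ∑ q, Function.update α i 0 q by omega⟩
    rcases eq_or_ne q i with rfl | hqi
    · simp
    · simpa [hqi] using hα.1 q (by simp [hqi, hq])
  · rintro ⟨β, j⟩ h
    rw [Finset.mem_sigma, mem_indices, Finset.mem_range] at h
    obtain ⟨⟨h1, h2⟩, h3⟩ := h
    simp only at h1 h2 h3
    rw [mem_indices, hsum β j (h1 i hi)]
    refine ⟨fun q hq => ?_, by omega⟩
    rw [List.mem_cons, not_or] at hq
    simpa [hq.1] using h1 q hq.2
  · intro α _
    simp
  · rintro ⟨β, j⟩ h
    rw [Finset.mem_sigma, mem_indices] at h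
    simp [← h.1.1 i hi]
  · intro α _
    simp

/-- Taylor's formula in the coordinate directions of a list. -/
theorem taylor_list {s : ℕ} (hs : 1 ≤ s) {f : (Fin d → ℝ) → ℝ}
    (hf : ContDiffOn ℝ (s : ℕ∞) f (cube d))
    (hb : ∀ α : Fin d → ℕ, ∑ i, α i ≤ s → ∀ x ∈ cube d, |multiDeriv α f x| ≤ 1)
    {κ : ℝ} {l : List (Fin d)} (hl : l <:+ List.finRange d) {b x : Fin d → ℝ}
    (hbc : b ∈ cube d) (hxc : x ∈ cube d) (hoff : ∀ i ∉ l, x i = b i)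
    (h0 : ∀ i, b i ≤ x i) (hκ : ∀ i, x i - b i ≤ κ) (hκ0 : 0 ≤ κ) :
    |f x - ∑ α ∈ indices s l, multiDeriv α f b * ∏ i, ((x i - b i) ^ α i / (α i).factorial)| ≤
      ((s : ℝ) + 1) ^ l.length * κ ^ s := by
  have hs' : (1 : ℝ) ≤ s := by exact_mod_cast hs
  induction l generalizing b with
  | nil =>
    have hxb : x = b := funext fun i => hoff i (by simp)
    have : indices s ([] : List (Fin d)) = {0} := by
      ext α
      rw [mem_indices, Finset.mem_singleton]
      constructor
      · intro h
        exact funext fun i => h.1 i (by simp)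
      · rintro rfl
        simp; omega
    rw [this, Finset.sum_singleton, ← listDeriv_eq_multiDeriv hl (by simp), hxb]
    simp only [listDeriv, List.foldr_nil, Pi.zero_apply, pow_zero, Nat.factorial_zero,
      Nat.cast_one, div_one, Finset.prod_const_one, mul_one, sub_self, abs_zero]
    positivity
  | cons i l ih =>
    have hl' : l <:+ List.finRange d := (List.suffix_cons i l).trans hl
    have hnd : (i :: l).Nodup := (List.nodup_finRange d).sublist hl.sublist
    have hil : i ∉ l := (List.nodup_cons.1 hnd).1
    -- Expand first around `b'`, which already agrees with `x` in coordinate `i`, then expand each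
    -- derivative at `b'` in direction `i` around `b`.
    set b' := Function.update b i (x i) with hb'
    have hb'c : b' ∈ cube d := update_mem_cube hbc i (mem_cube.1 hxc i)
    have hIH := ih hl' (b := b') hb'c (fun q hq => by
        rcases eq_or_ne q i with rfl | hqi
        · simp [hb']
        · simpa [hb', hqi] using hoff q (by simp [hqi, hq])) (fun q => by
        rcases eq_or_ne q i with rfl | hqi
        · simp [hb']
        · simpa [hb', hqi] using h0 q) (fun q => by
        rcases eq_or_ne q i with rfl | hqi
        · simpa [hb'] using hκ0
        · simpa [hb', hqi] using hκ q)
    set G : (Fin d → ℕ) → ℝ := fun β => ∏ q, ((x q - b q) ^ β q / (β q).factorial) with hG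
    have hGabs : ∀ β, 0 ≤ G β ∧ G β ≤ κ ^ ∑ q, β q := fun β => by
      have hpos : ∀ q, 0 ≤ x q - b q := fun q => by linarith [h0 q]
      refine ⟨Finset.prod_nonneg fun q _ => div_nonneg (pow_nonneg (hpos q) _) (by positivity), ?_⟩
      rw [← Finset.prod_pow_eq_pow_sum]
      refine Finset.prod_le_prod
        (fun q _ => div_nonneg (pow_nonneg (hpos q) _) (by positivity)) fun q _ => ?_
      refine (div_le_self (pow_nonneg (hpos q) _) ?_).trans
        (pow_le_pow_left₀ (hpos q) (hκ q) _)
      exact_mod_cast Nat.factorial_pos _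
    have hGi : ∀ β : Fin d → ℕ, β i = 0 → ∀ j, G (Function.update β i j) =
        (x i - b i) ^ j / j.factorial * G β := fun β hβ j => by
      simp only [hG]
      rw [Finset.prod_eq_mul_prod_sdiff_singleton_of_mem (Finset.mem_univ i),
        Finset.prod_eq_mul_prod_sdiff_singleton_of_mem (Finset.mem_univ i)
          (fun q => (x q - b q) ^ β q / ((β q).factorial : ℝ)), hβ]
      simp only [Function.update_self, pow_zero, Nat.factorial_zero, Nat.cast_one, div_one,
        one_mul]
      congr 1
      refine Finset.prod_congr rfl fun q hq => ?_
      rw [Function.update_of_ne (by simpa using hq)]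
    have hG' : ∀ β : Fin d → ℕ, β i = 0 →
        ∏ q, ((x q - b' q) ^ β q / ((β q).factorial : ℝ)) = G β := fun β hβ => by
      refine Finset.prod_congr rfl fun q _ => ?_
      rcases eq_or_ne q i with rfl | hqi
      · simp [hβ]
      · simp [hb', hqi]
    have hterm : ∀ β ∈ indices s l, |multiDeriv β f b' * G β - ∑ j ∈ Finset.range (s - ∑ q, β q),
        multiDeriv (Function.update β i j) f b * G (Function.update β i j)| ≤ κ ^ s := by
      intro β hβ
      obtain ⟨hβ0, hβs⟩ := mem_indices.1 hβ
      have hsm := sum_map_list (List.nodup_cons.1 hnd).2 hβ0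
      have hmd : ∀ j, multiDeriv (Function.update β i j) f =
          (partialDeriv i)^[j] (listDeriv l β f) := fun j => by
        rw [← listDeriv_eq_multiDeriv hl, listDeriv_cons, Function.update_self]
        · rw [listDeriv_congr (β := β)]
          intro q hq
          rw [Function.update_of_ne]
          rintro rfl
          exact hil hq
        · intro q hq
          rw [List.mem_cons, not_or] at hq
          rw [Function.update_of_ne hq.1]
          exact hβ0 q hq.2
      -- The order `s - |β|` leaves an error `κ^(s - |β|)`, and the monomial of `β` supplies the
      -- missing `κ^|β|`.
      have hT := taylor_coordinate (n := s - ∑ q, β q) (g := listDeriv l β f)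
        (contDiffOn_listDeriv (by rw [hsm, Nat.sub_add_cancel hβs.le]; exact hf)) i
        (by
          rw [← hmd]
          refine hb _ ?_
          rw [Finset.sum_update_of_mem (Finset.mem_univ i)]
          rw [Finset.sum_eq_add_sum_sdiff_singleton_of_mem (Finset.mem_univ i) β, hβ0 i hil] at *
          omega) hbc (h0 i) (mem_cube.1 hxc i).2
      have heq : multiDeriv β f b' * G β - ∑ j ∈ Finset.range (s - ∑ q, β q),
          multiDeriv (Function.update β i j) f b * G (Function.update β i j) =
          (listDeriv l β f b' - ∑ j ∈ Finset.range (s - ∑ q, β q),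
            (partialDeriv i)^[j] (listDeriv l β f) b *
              ((x i - b i) ^ j / j.factorial)) * G β := by
        rw [sub_mul, Finset.sum_mul, listDeriv_eq_multiDeriv hl' hβ0]
        congr 1
        refine Finset.sum_congr rfl fun j _ => ?_
        rw [hmd, hGi β (hβ0 i hil), listDeriv_eq_multiDeriv hl' hβ0, mul_assoc]
      rw [heq, abs_mul, abs_of_nonneg (hGabs β).1]
      calc _ ≤ κ ^ (s - ∑ q, β q) * κ ^ ∑ q, β q := by
            refine mul_le_mul (hT.trans ?_) (hGabs β).2 (hGabs β).1 (by positivity)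
            exact pow_le_pow_left₀ (by linarith [h0 i]) (hκ i) _
        _ = κ ^ s := by rw [← pow_add, Nat.sub_add_cancel hβs.le]
    have hsum : |∑ β ∈ indices s l, multiDeriv β f b' * ∏ q, ((x q - b' q) ^ β q /
        ((β q).factorial : ℝ)) - ∑ α ∈ indices s (i :: l), multiDeriv α f b * G α| ≤
        (s : ℝ) ^ l.length * κ ^ s := by
      rw [sum_indices_cons hil, ← Finset.sum_sub_distrib]
      refine (Finset.abs_sum_le_sum_abs _ _).trans ?_
      calc _ ≤ ∑ β ∈ indices s l, κ ^ s := Finset.sum_le_sum fun β hβ => by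
            rw [hG' β ((mem_indices.1 hβ).1 i hil)]
            exact hterm β hβ
        _ = (indices s l).card * κ ^ s := by rw [Finset.sum_const, nsmul_eq_mul]
        _ ≤ _ := by
          gcongr
          exact_mod_cast card_indices_le (List.nodup_cons.1 hnd).2
    have hfin := (abs_sub_le _ _ _).trans (add_le_add hIH hsum)
    refine hfin.trans ?_
    -- With `m` the length of `l`, the constants add up by `(s+1)^m + s^m ≤ (s+1)^(m+1)`, which uses
    -- `s ≥ 1`.
    rw [← add_mul, List.length_cons, pow_succ, mul_add_one, add_comm]
    gcongr
    calc (s : ℝ) ^ l.length ≤ (s + 1) ^ l.length := by gcongr; linarith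
      _ ≤ _ := le_mul_of_one_le_right (by positivity) hs'

end Taylor

/-! ### One Taylor term: quantized coefficient times monomial -/

section Term

theorem prod_range_getElem? {ι : Type*} (l : List ι) (h : ι → ℝ) {r : ℕ} (hr : l.length ≤ r) :
    ∏ j ∈ Finset.range r, (l[j]?).elim 1 h = (l.map h).prod := by
  induction l generalizing r with
  | nil => simp
  | cons i l ih =>
    obtain ⟨r, rfl⟩ : ∃ r', r = r' + 1 := ⟨r - 1, by simp at hr; omega⟩
    rw [Finset.prod_range_succ', List.map_cons, List.prod_cons,
      ← ih (by simpa using hr), mul_comm]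
    simp

theorem exists_list_monomial {ι : Type*} (α : ι → ℕ) (L : List ι) :
    ∃ l : List ι, l.length = (L.map α).sum ∧
      ∀ h : ι → ℝ, (l.map h).prod = (L.map fun i => h i ^ α i).prod := by
  induction L with
  | nil => exact ⟨[], by simp⟩
  | cons i L ih =>
    obtain ⟨l, hl, hp⟩ := ih
    exact ⟨List.replicate (α i) i ++ l, by simp [hl], fun h => by simp [hp]⟩

/-- The code exists for every `ξ`, with junk value 0 outside `[0, 1]`, so that one can be chosen for
all indices although only attained ones have bounded coefficients. -/
theorem exists_quantize {D : ℕ} (hD : 0 < D) (ξ : ℝ) :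
    ∃ c : Fin D, 0 ≤ ξ → ξ ≤ 1 → |ξ - ((c : ℕ) : ℝ) / D| ≤ 1 / D := by
  by_cases h : 0 ≤ ξ ∧ ξ ≤ 1
  · have hD' : (0 : ℝ) < D := by exact_mod_cast hD
    obtain ⟨j, hj, h0, h1⟩ := exists_piece hD (w := D * ξ) (mul_nonneg hD'.le h.1)
      (mul_le_of_le_one_right hD'.le h.2)
    refine ⟨⟨j, hj⟩, fun _ _ => ?_⟩
    have h2 : ξ - (j : ℝ) / D = (D * ξ - j) / D := by field_simp
    simp only [h2]
    rw [abs_of_nonneg (div_nonneg (by linarith) hD'.le)]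
    gcongr
    linarith
  · exact ⟨⟨0, hD⟩, fun h0 h1 => absurd ⟨h0, h1⟩ h⟩

theorem two_mul_succ_le_four_pow {s : ℕ} (hs : 1 ≤ s) : 2 * (s + 1) ≤ 4 ^ s := by
  induction s, hs using Nat.le_induction with
  | base => norm_num
  | succ s _ ih => rw [pow_succ]; omega

/-- Multiplication is available only in `[0, 1]`, so a signed `D` enters as `(D + 1)/2`, and `D p =
2 ((D + 1)/2) p - p` undoes the shift. -/
theorem abs_signed_product_le {z p c D q ε ε' e : ℝ} (hD : |D| ≤ 1) (hp : |p| ≤ 1)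
    (hz : |z - c * p| ≤ ε) (hc : |(D + 1) / 2 - c| ≤ ε') (hpq : |p - q| ≤ e) :
    |2 * z - p - D * q| ≤ 2 * ε + 2 * ε' + e := by
  have h1 : |((D + 1) / 2 - c) * p| ≤ ε' := by
    rw [abs_mul]
    exact (mul_le_of_le_one_right (abs_nonneg _) hp).trans hc
  have h2 : |D * (p - q)| ≤ e := by
    rw [abs_mul]
    exact (mul_le_of_le_one_left (abs_nonneg _) hD).trans hpq
  have h3 : 2 * z - p - D * q =
      2 * (z - c * p) - 2 * (((D + 1) / 2 - c) * p) + D * (p - q) := by ring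
  rw [h3, abs_le]
  rw [abs_le] at hz h1 h2
  constructor <;> linarith

variable {X : Type*} {d : ℕ}

/-- Approximation of a tabulated coefficient times a monomial. -/
theorem Reach.term_fit {N L s J : ℕ} (hN : 0 < N) (hL : 0 < L) (hs : 1 ≤ s)
    (hJ : 4 ^ s ≤ (2 * N) ^ J) {k : X → ℕ} (hk : ∀ x, k x < (N * L) * (N * L))
    {h : Fin d → X → ℝ} (hh : ∀ i x, 0 ≤ h i x ∧ h i x ≤ 1) (c : ℕ → ℝ)
    (hc : ∀ x, |c (k x)| ≤ 1) {α : Fin d → ℕ} (hα : ∑ i, α i < s) :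
    ∃ t : X → ℝ, (∀ x, |t x - c (k x) * ∏ i, h i x ^ α i| ≤ 3 / ((2 * N : ℕ) : ℝ) ^ J) ∧
      Reach (8 * N + 10 + 2 * d) (insert (fun x => (k x : ℝ)) (range h))
        (2 * L + 3 + L * (J + 2) + s * (J + 2)) {t} := by
  have hB : 0 < 2 * N := by omega
  have hD : 0 < (2 * N) ^ J := by positivity
  choose e he using fun n => exists_quantize hD ((c n + 1) / 2)
  have hfit := Reach.point_fit hN hL hB J hk e
  set q : X → ℝ := fun x => ((e (k x) : ℕ) : ℝ) with hq
  have hhcard : (range h).encard ≤ d := by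
    rw [← image_univ]
    exact (encard_image_le _ _).trans (by simp)
  have h1 : Reach (8 * N + 10 + 2 * d) (insert (fun x => (k x : ℝ)) (range h))
      (2 * L + 3 + L * (J + 2)) ({q} ∪ range h) := by
    refine ((hfit.source ?_).par ((Reach.carry hhcard _).source ?_)).mono (by omega)
    · rintro _ rfl; exact mem_affSpan (mem_insert _ _)
    · exact (subset_insert _ _).trans subset_affSpan
  obtain ⟨l, hl, hlp⟩ := exists_list_monomial α (List.finRange d)
  rw [← Fin.sum_univ_def] at hl
  have hTcard : ({q} ∪ range h : Set (X → ℝ)).encard ≤ (d + 1 : ℕ) := by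
    refine (encard_union_le _ _).trans ?_
    rw [encard_singleton, add_comm]
    push_cast
    gcongr
  obtain ⟨p, hp, hpe, hpR⟩ := Reach.prod_fit hB J hTcard
    (fun j x => (l[j]?).elim 1 fun i => h i x) (fun j => by
      rcases l[j]? with _ | i
      · exact affSpan_const 1
      · exact mem_affSpan (Or.inr ⟨i, rfl⟩)) (fun j x => by
      rcases l[j]? with _ | i
      · simp
      · exact hh i x) (s - 1)
  have hq01 : ∀ x, 0 ≤ (((2 * N) ^ J : ℕ) : ℝ)⁻¹ * q x ∧ (((2 * N) ^ J : ℕ) : ℝ)⁻¹ * q x ≤ 1 := by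
    intro x
    refine ⟨by positivity, ?_⟩
    rw [inv_mul_le_one₀ (by exact_mod_cast hD)]
    simp only [hq]
    exact_mod_cast (e (k x)).2.le
  obtain ⟨z, -, hze, hzR⟩ := Reach.mul_fit hB J (fun x => (((2 * N) ^ J : ℕ) : ℝ)⁻¹ * q x) p
    hq01 hp
  refine ⟨fun x => 2 * z x - p x, fun x => ?_, ?_⟩
  · have hprod := prod_range_getElem? l (fun i => h i x) (r := s - 1) (by omega)
    rw [hlp, ← Fin.prod_univ_def] at hprod
    have hpx := hpe x
    rw [hprod] at hpx
    have hcx := abs_le.1 (hc x)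
    have hex := he (k x) (by linarith) (by linarith)
    have hex' : |(c (k x) + 1) / 2 - (((2 * N) ^ J : ℕ) : ℝ)⁻¹ * q x| ≤
        1 / (((2 * N) ^ J : ℕ) : ℝ) := by
      rw [← div_eq_inv_mul]
      exact hex
    have hmain := abs_signed_product_le (hc x) (abs_le.2 ⟨by linarith [(hp x).1], (hp x).2⟩)
      (hze x) hex' hpx
    refine hmain.trans ?_
    set E : ℝ := ((2 * N : ℕ) : ℝ) ^ J with hE
    have hE4 : (4 : ℝ) ^ s ≤ E := by rw [hE]; exact_mod_cast hJ
    have hs4 : 2 * ((s : ℝ) + 1) ≤ 4 ^ s := by exact_mod_cast two_mul_succ_le_four_pow hs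
    have hE0 : 0 < E := lt_of_lt_of_le (by positivity) hE4
    have h2 : (((2 * N : ℕ) : ℝ) ^ 2) ^ J = E * E := by rw [hE, ← pow_mul, ← pow_add]; ring_nf
    rw [h2, Nat.cast_pow, ← hE, Nat.cast_sub hs, Nat.cast_one]
    -- The errors of the last product, of the quantization and of the monomial with `s - 1` factors.
    -- Since `2(s+1) ≤ 4^s ≤ E`, their sum is at most `3 / E`.
    have h3 : 2 * (2 / (E * E)) + 2 * (1 / E) + ((s : ℝ) - 1) * (2 / (E * E)) =
        (2 * ((s : ℝ) + 1) / E + 2) / E := by field_simp; ring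
    rw [h3]
    gcongr
    have : 2 * ((s : ℝ) + 1) / E ≤ 1 := (div_le_one hE0).2 (hs4.trans hE4)
    linarith
  · have h2 : Reach (8 * N + 10 + 2 * d) ({q} ∪ range h ∪ {p}) (J + 2) ({z} ∪ {p}) := by
      refine ((hzR.source ?_).par ((Reach.carry (n := 1) (T := {p}) (by simp) _).source
        ?_)).mono (by omega)
      · rintro _ (rfl | rfl)
        · exact affSpan_mul _ (mem_affSpan (by simp))
        · exact mem_affSpan (Or.inr rfl)
      · exact subset_union_right.trans subset_affSpan
    have h3 := (h1.trans (hpR.mono (by omega))).trans h2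
    rw [show 2 * L + 3 + L * (J + 2) + s * (J + 2) =
      2 * L + 3 + L * (J + 2) + (s - 1) * (J + 2) + (J + 2) by
        obtain ⟨r, rfl⟩ : ∃ r, s = r + 1 := ⟨s - 1, by omega⟩
        simp; ring]
    refine h3.target ?_
    rintro _ rfl
    exact affSpan_sub (affSpan_mul 2 (mem_affSpan (Or.inl rfl))) (mem_affSpan (Or.inr rfl))

end Term

/-! ### Locating the cell of a point -/

section Grid

/-- The number of the cell of `[0, 1]`, subdivided into `K` cells, that contains `t`. -/
noncomputable def cellIndex (K : ℕ) (t : ℝ) : ℕ := min ⌊K * t⌋₊ (K - 1)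

theorem cellIndex_lt {K : ℕ} (hK : 0 < K) (t : ℝ) : cellIndex K t < K :=
  (min_le_right _ _).trans_lt (Nat.sub_lt hK one_pos)

variable {d K : ℕ} {δ : ℝ}

/-- Below each interior grid point the trifling region removes exactly the interval of length `δ`
where the margin would fail. The last cell has no such gap and contains the endpoint 1; cutting `x
i` off at `1 - δ` restores the margin there. -/
theorem near_cell (hδK : δ ≤ 1 / (3 * (K : ℝ))) (hK : 0 < K) (i : Fin d) :
    Near (fun x : ↥(cube d \ triflingRegion d K δ) => cellIndex K (x.1 i))
      (fun x => K * min (x.1 i) (1 - δ)) (K * δ) := by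
  rintro ⟨x, hx, hxt⟩
  have hK' : (0 : ℝ) < K := by exact_mod_cast hK
  have hKδ : K * δ ≤ 1 / 3 := by
    have := mul_le_mul_of_nonneg_left hδK hK'.le
    rwa [show (K : ℝ) * (1 / (3 * K)) = 1 / 3 by field_simp] at this
  obtain ⟨h0, h1⟩ := mem_cube.1 hx i
  have hKx : 0 ≤ K * x i := mul_nonneg hK'.le h0
  have hmin : K * min (x i) (1 - δ) = min (K * x i) (K - K * δ) := by
    rw [mul_min_of_nonneg _ _ hK'.le]
    ring_nf
  simp only [hmin, cellIndex]
  rcases lt_or_ge (⌊K * x i⌋₊ + 1) K with h | h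
  · have hq := Nat.floor_le hKx
    have hq1 := Nat.lt_floor_add_one (K * x i)
    have hqK : (⌊K * x i⌋₊ : ℝ) + 2 ≤ K := by exact_mod_cast h
    rw [min_eq_left (by omega)]
    refine ⟨le_min hq (by linarith), (min_le_left _ _).trans ?_⟩
    by_contra! hcon
    refine hxt (mem_iUnion.2 ⟨i, hx, ⌊K * x i⌋₊ + 1, by omega, h, ?_, ?_⟩)
    · push_cast
      rw [div_sub' hK'.ne', div_lt_iff₀ hK']
      linarith
    · push_cast
      rw [lt_div_iff₀ hK']
      linarith
  · have hq : ((K - 1 : ℕ) : ℝ) ≤ K * x i :=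
      (Nat.cast_le.2 (by omega)).trans (Nat.floor_le hKx)
    rw [min_eq_right (by omega)]
    rw [Nat.cast_pred hK] at hq ⊢
    exact ⟨le_min hq (by linarith), (min_le_right _ _).trans (by linarith)⟩

/-- Computing the cell of a point outside the trifling region. -/
theorem Reach.cell {N L : ℕ} (hN : 0 < N) (hL : 0 < L) (hKNL : K ≤ (N * L) * (N * L))
    (hδ : 0 < δ) (hδK : δ ≤ 1 / (3 * (K : ℝ))) (hK : 0 < K) (i : Fin d) :
    Reach (2 * N + 8)
      {fun x : ↥(cube d \ triflingRegion d K δ) => x.1 i} (1 + (L + L))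
      {fun x => x.1 i, fun x => (cellIndex K (x.1 i) : ℝ)} := by
  have hK' : (0 : ℝ) < K := by exact_mod_cast hK
  set c : ↥(cube d \ triflingRegion d K δ) → ℝ := fun x => x.1 i with hc
  set y : ↥(cube d \ triflingRegion d K δ) → ℝ := fun x => K * min (x.1 i) (1 - δ) with hy
  have h1 : Reach (2 * N + 8) {c} 1 {c, y} := by
    have h := (Reach.carry (n := 1) (T := {c}) (by simp) 1).par
      (Reach.single (w := 1) (T := {c}) (G := {fun x => 1 - δ - c x}) (by
        rintro _ rfl
        exact affSpan_sub (affSpan_const _) (mem_affSpan rfl)) (by simp) subset_affSpan)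
    refine (h.mono (by omega)).target ?_
    rintro _ (rfl | rfl)
    · exact mem_affSpan (by simp)
    · refine affSpan_congr _ (affSpan_mul (K : ℝ) (affSpan_sub (affSpan_const (1 - δ))
        (mem_affSpan (Or.inr ⟨_, rfl, rfl⟩)))) fun x => ?_
      simp only [hy, hc, reluFun]
      congr 1
      rcases le_total (x.1 i) (1 - δ) with h | h
      · rw [min_eq_left h, max_eq_right (by linarith)]; ring
      · rw [min_eq_right h, max_eq_left (by linarith)]; ring
  have h2 := Reach.round (mul_pos hK' hδ) (near_cell hδK hK i) hN hL fun x =>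
    (cellIndex_lt hK _).trans_le hKNL
  refine h1.trans ((((Reach.carry (n := 1) (T := {c}) (by simp) _).source ?_).par
    (h2.source ?_)).mono (by omega))
  · rintro _ rfl; exact mem_affSpan (by simp)
  · rintro _ rfl; exact mem_affSpan (by simp [hy])

end Grid

/-! ### Estimates for the grid size and logarithms -/

section Sizes

theorem gridSize_pos {d N L : ℕ} (hN : 1 ≤ N) (hL : 1 ≤ L) : 0 < gridSize d N L := by
  have h1 : 1 ≤ ⌊(N : ℝ) ^ ((1 : ℝ) / d)⌋₊ :=
    Nat.le_floor (by simpa using Real.one_le_rpow (by exact_mod_cast hN) (by positivity))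
  have h2 : 1 ≤ ⌊(L : ℝ) ^ ((2 : ℝ) / d)⌋₊ :=
    Nat.le_floor (by simpa using Real.one_le_rpow (by exact_mod_cast hL) (by positivity))
  exact Nat.mul_pos (pow_pos h1 2) h2

theorem gridSize_pow_le {d N L : ℕ} (hd : 1 ≤ d) : gridSize d N L ^ d ≤ (N * L) * (N * L) := by
  have hd' : (d : ℝ) ≠ 0 := by positivity
  have h1 : (⌊(N : ℝ) ^ ((1 : ℝ) / d)⌋₊ : ℝ) ^ d ≤ N := by
    refine (pow_le_pow_left₀ (by positivity) (Nat.floor_le (by positivity)) d).trans_eq ?_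
    rw [← Real.rpow_natCast, ← Real.rpow_mul (by positivity), one_div_mul_cancel hd', Real.rpow_one]
  have h2 : (⌊(L : ℝ) ^ ((2 : ℝ) / d)⌋₊ : ℝ) ^ d ≤ L ^ 2 := by
    refine (pow_le_pow_left₀ (by positivity) (Nat.floor_le (by positivity)) d).trans_eq ?_
    rw [← Real.rpow_natCast, ← Real.rpow_mul (by positivity), div_mul_cancel₀ _ hd']
    norm_cast
  have h1' : ⌊(N : ℝ) ^ ((1 : ℝ) / d)⌋₊ ^ d ≤ N := by exact_mod_cast h1
  have h2' : ⌊(L : ℝ) ^ ((2 : ℝ) / d)⌋₊ ^ d ≤ L ^ 2 := by exact_mod_cast h2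
  calc gridSize d N L ^ d
      = (⌊(N : ℝ) ^ ((1 : ℝ) / d)⌋₊ ^ d) ^ 2 * ⌊(L : ℝ) ^ ((2 : ℝ) / d)⌋₊ ^ d := by
        rw [gridSize, mul_pow, ← pow_mul, ← pow_mul, mul_comm 2]
    _ ≤ N ^ 2 * L ^ 2 := Nat.mul_le_mul (Nat.pow_le_pow_left h1' 2) h2'
    _ = _ := by ring

theorem half_le_floor {a : ℝ} (ha : 1 ≤ a) : a / 2 ≤ ⌊a⌋₊ := by
  have h1 := Nat.lt_floor_add_one a
  have h2 : (1 : ℝ) ≤ ⌊a⌋₊ := by exact_mod_cast Nat.le_floor (by simpa using ha)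
  linarith

/-- Each of the three floors in `K` loses at most a factor 2, which accounts for `8 ^ s`. -/
theorem inv_gridSize_pow_le {d N L : ℕ} (hN : 1 ≤ N) (hL : 1 ≤ L) (s : ℕ) :
    (1 / (gridSize d N L : ℝ)) ^ s ≤
      8 ^ s * ((N : ℝ) ^ (-(2 * (s : ℝ) / d)) * (L : ℝ) ^ (-(2 * (s : ℝ) / d))) := by
  have hN' : (1 : ℝ) ≤ N := by exact_mod_cast hN
  have hL' : (1 : ℝ) ≤ L := by exact_mod_cast hL
  set a := (N : ℝ) ^ ((1 : ℝ) / d) with ha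
  set b := (L : ℝ) ^ ((2 : ℝ) / d) with hb
  have ha1 : 1 ≤ a := Real.one_le_rpow hN' (by positivity)
  have hb1 : 1 ≤ b := Real.one_le_rpow hL' (by positivity)
  have hG : a ^ 2 * b / 8 ≤ gridSize d N L := by
    rw [gridSize]
    push_cast
    calc a ^ 2 * b / 8 = (a / 2) ^ 2 * (b / 2) := by ring
      _ ≤ _ := mul_le_mul (pow_le_pow_left₀ (by positivity) (half_le_floor ha1) 2)
        (half_le_floor hb1) (by positivity) (by positivity)
  have hNs : (N : ℝ) ^ (-(2 * (s : ℝ) / d)) = ((a ^ 2) ^ s)⁻¹ := by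
    rw [Real.rpow_neg (by positivity), ha, ← pow_mul, ← Real.rpow_natCast,
      ← Real.rpow_mul (by positivity)]
    congr 2
    push_cast
    ring
  have hLs : (L : ℝ) ^ (-(2 * (s : ℝ) / d)) = (b ^ s)⁻¹ := by
    rw [Real.rpow_neg (by positivity), hb, ← Real.rpow_natCast, ← Real.rpow_mul (by positivity)]
    congr 2
    ring
  calc (1 / (gridSize d N L : ℝ)) ^ s ≤ (1 / (a ^ 2 * b / 8)) ^ s := by gcongr
    _ = _ := by
      rw [hNs, hLs, one_div, inv_div, div_pow, mul_pow, div_eq_mul_inv, mul_inv]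

theorem le_two_mul_pow_log (N L : ℕ) : N * L ≤ (2 * N) ^ (Nat.log 2 L + 1) := by
  rw [mul_pow, mul_comm]
  exact Nat.mul_le_mul (Nat.lt_pow_succ_log_self (by norm_num) L).le
    (Nat.le_self_pow (by omega) N)

theorem log_add_two_le {L : ℕ} (hL : 1 ≤ L) : (Nat.log 2 L : ℝ) + 2 ≤ Real.logb 2 (4 * L) := by
  rw [Real.le_logb_iff_rpow_le (by norm_num) (by positivity)]
  have : 2 ^ (Nat.log 2 L + 2) ≤ 4 * L := by
    rw [pow_add, mul_comm]
    exact Nat.mul_le_mul (by norm_num) (Nat.pow_log_le_self 2 (by omega))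
  exact_mod_cast this

theorem three_le_logb {N : ℕ} (hN : 1 ≤ N) : 3 ≤ Real.logb 2 (8 * N) := by
  have hN' : (1 : ℝ) ≤ N := by exact_mod_cast hN
  rw [Real.le_logb_iff_rpow_le (by norm_num) (by positivity)]
  norm_num
  linarith

end Sizes

/-! ### Assembly and size bounds -/

section Main

theorem continuousOn_multiDeriv {d s : ℕ} {f : (Fin d → ℝ) → ℝ}
    (hf : ContDiffOn ℝ (s : ℕ∞) f (cube d)) {α : Fin d → ℕ} (hα : ∑ i, α i ≤ s) :
    ContinuousOn (multiDeriv α f) (cube d) := by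
  refine ContDiffOn.continuousOn (𝕜 := ℝ) (n := ((s - ∑ i, α i : ℕ) : ℕ∞))
    (contDiffOn_listDeriv (l := List.finRange d) ?_)
  rw [← Fin.sum_univ_def, Nat.sub_add_cancel hα]
  exact hf

/-- The lower-left corner of the cell with a given number. -/
noncomputable def gridPoint (d K n : ℕ) : Fin d → ℝ := fun i => ((n / K ^ (i : ℕ) % K : ℕ) : ℝ) / K

theorem width_bound {N d s : ℕ} (hN : 1 ≤ N) (hd : 1 ≤ d) (hs : 1 ≤ s) {w : ℕ}
    (hw : w ≤ s ^ d * (8 * N + 10 + 2 * d) ∨ w ≤ d * (2 * N + 8)) :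
    (w : ℝ) ≤ 16 * (s : ℝ) ^ (d + 1) * d * (N + 2) * Real.logb 2 (8 * N) := by
  -- Here `48 = 16 * 3`, and the factor 3 is absorbed by `log₂ (8N) ≥ 3`.
  have h1 : w ≤ 48 * s ^ (d + 1) * d * (N + 2) := by
    have hsd : 1 ≤ s ^ d := Nat.one_le_pow _ _ hs
    have hsd' : s ^ d ≤ s ^ (d + 1) := Nat.pow_le_pow_right hs (by omega)
    have h2 : 8 * N + 10 + 2 * d ≤ 48 * d * (N + 2) := by nlinarith
    have h3 : d * (2 * N + 8) ≤ 48 * d * (N + 2) := by nlinarith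
    rcases hw with hw | hw
    · calc w ≤ s ^ d * (8 * N + 10 + 2 * d) := hw
        _ ≤ s ^ (d + 1) * (48 * d * (N + 2)) := Nat.mul_le_mul hsd' h2
        _ = _ := by ring
    · calc w ≤ 1 * (d * (2 * N + 8)) := by rw [one_mul]; exact hw
        _ ≤ s ^ (d + 1) * (48 * d * (N + 2)) := Nat.mul_le_mul (hsd.trans hsd') h3
        _ = _ := by ring
  have h2 : (w : ℝ) ≤ 16 * (s : ℝ) ^ (d + 1) * d * (N + 2) * 3 := by
    calc (w : ℝ) ≤ ((48 * s ^ (d + 1) * d * (N + 2) : ℕ) : ℝ) := by exact_mod_cast h1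
      _ = _ := by push_cast; ring
  refine h2.trans ?_
  gcongr
  exact three_le_logb hN

theorem depth_bound {L s : ℕ} (hL : 1 ≤ L) (hs : 1 ≤ s) :
    ((1 + (L + L) + (2 * L + 3 + L * (2 * s * (Nat.log 2 L + 1) + 2) +
      s * (2 * s * (Nat.log 2 L + 1) + 2)) : ℕ) : ℝ) ≤
      18 * (s : ℝ) ^ 2 * (L + 2) * Real.logb 2 (4 * L) := by
  have h1 : 1 + (L + L) + (2 * L + 3 + L * (2 * s * (Nat.log 2 L + 1) + 2) +
      s * (2 * s * (Nat.log 2 L + 1) + 2)) ≤ 18 * s ^ 2 * (L + 2) * (Nat.log 2 L + 2) := by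
    generalize Nat.log 2 L = t
    have h2 : L + s ≤ s * (L + 2) := by nlinarith
    have h3 : 2 * s * (t + 1) + 2 ≤ 2 * s * (t + 2) := by nlinarith
    have h4 : 1 ≤ s ^ 2 := Nat.one_le_pow _ _ hs
    have h5 : 4 * (L + 2) * 1 ≤ 4 * (L + 2) * (s ^ 2 * (t + 2)) :=
      Nat.mul_le_mul_left _ (Nat.mul_pos h4 (by omega))
    calc _ = 4 * L + 4 + (L + s) * (2 * s * (t + 1) + 2) := by ring
      _ ≤ 4 * (L + 2) * (s ^ 2 * (t + 2)) + s * (L + 2) * (2 * s * (t + 2)) :=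
        add_le_add (by omega) (Nat.mul_le_mul h2 h3)
      _ = 6 * (s ^ 2 * (L + 2) * (t + 2)) := by ring
      _ ≤ 18 * (s ^ 2 * (L + 2) * (t + 2)) := Nat.mul_le_mul_right _ (by norm_num)
      _ = _ := by ring
  calc _ ≤ ((18 * s ^ 2 * (L + 2) * (Nat.log 2 L + 2) : ℕ) : ℝ) := by exact_mod_cast h1
    _ = 18 * (s : ℝ) ^ 2 * (L + 2) * (Nat.log 2 L + 2) := by push_cast; ring
    _ ≤ _ := by
      gcongr
      exact log_add_two_le hL

/-- The network approximating the Taylor polynomials at the lower-left corners of the cells. -/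
theorem Reach.taylor_fit {d s N L K J : ℕ} {δ : ℝ} (hd : 1 ≤ d) (hs : 1 ≤ s) (hN : 0 < N)
    (hL : 0 < L) (hK : 0 < K) (hKd : K ^ d ≤ (N * L) * (N * L)) (hJ : 4 ^ s ≤ (2 * N) ^ J)
    (hJK : K ^ s ≤ (2 * N) ^ J) (hδ : 0 < δ) (hδK : δ ≤ 1 / (3 * (K : ℝ)))
    {f : (Fin d → ℝ) → ℝ} (hf : ContDiffOn ℝ (s : ℕ∞) f (cube d))
    (hb : ∀ α : Fin d → ℕ, ∑ i, α i ≤ s → ∀ x ∈ cube d, |multiDeriv α f x| ≤ 1) :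
    ∃ φ : ↥(cube d \ triflingRegion d K δ) → ℝ,
      (∀ x, |φ x - f x| ≤ 4 * (((s : ℝ) + 1) ^ d * (1 / (K : ℝ)) ^ s)) ∧
      Reach (max (s ^ d * (8 * N + 10 + 2 * d)) (d * (2 * N + 8)))
        (range fun i x => x.1 i)
        (1 + (L + L) + (2 * L + 3 + L * (J + 2) + s * (J + 2))) {φ} := by
  set X := ↥(cube d \ triflingRegion d K δ) with hX
  have hK' : (0 : ℝ) < K := by exact_mod_cast hK
  have hKNL : K ≤ (N * L) * (N * L) := (Nat.le_self_pow (by omega) K).trans hKd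
  set k : Fin d → X → ℕ := fun i x => cellIndex K (x.1 i) with hk
  have hkK : ∀ i x, k i x < K := fun i x => cellIndex_lt hK _
  -- The number of the cell has the coordinate indices as digits in base `K`. It is affine in them,
  -- so forming it takes no layer.
  set n : X → ℕ := fun x =>
    (finFunctionFinEquiv (fun i => (⟨k i x, hkK i x⟩ : Fin K)) : Fin (K ^ d)) with hn
  have hnlt : ∀ x, n x < (N * L) * (N * L) := fun x => (Fin.is_lt _).trans_le hKd
  have hnsum : ∀ x, (n x : ℝ) = ∑ i : Fin d, (K : ℝ) ^ (i : ℕ) * k i x := fun x => by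
    simp only [hn, finFunctionFinEquiv_apply]
    push_cast
    exact Finset.sum_congr rfl fun i _ => mul_comm _ _
  have hgrid : ∀ x i, gridPoint d K (n x) i = (k i x : ℝ) / K := fun x i => by
    have := finFunctionFinEquiv_symm_apply_val
      (finFunctionFinEquiv (fun i => (⟨k i x, hkK i x⟩ : Fin K))) i
    rw [Equiv.symm_apply_apply] at this
    simp only [gridPoint, hn, ← this]
  set h : Fin d → X → ℝ := fun i x => x.1 i - (K : ℝ)⁻¹ * k i x with hh
  have hhK : ∀ i x, 0 ≤ h i x ∧ h i x ≤ 1 / (K : ℝ) := fun i x => by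
    obtain ⟨h0, h1⟩ := mem_cube.1 x.2.1 i
    have hx0 : 0 ≤ K * x.1 i := mul_nonneg hK'.le h0
    have h2 : (k i x : ℝ) ≤ K * x.1 i :=
      (Nat.cast_le.2 (min_le_left _ _)).trans (Nat.floor_le hx0)
    have h3 : K * x.1 i ≤ k i x + 1 := by
      simp only [hk, cellIndex]
      rcases le_total ⌊K * x.1 i⌋₊ (K - 1) with hle | hle
      · rw [min_eq_left hle]
        exact (Nat.lt_floor_add_one _).le
      · rw [min_eq_right hle, Nat.cast_pred hK]
        nlinarith
    have h4 : h i x = (K * x.1 i - k i x) / K := by simp only [hh]; field_simp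
    rw [h4]
    exact ⟨div_nonneg (by linarith) hK'.le, by gcongr; linarith⟩
  have hh01 : ∀ i x, 0 ≤ h i x ∧ h i x ≤ 1 := fun i x =>
    ⟨(hhK i x).1, (hhK i x).2.trans (by rw [div_le_one hK']; exact_mod_cast hK)⟩
  have hhg : ∀ x i, x.1 i - gridPoint d K (n x) i = h i x := fun x i => by
    rw [hgrid]; simp only [hh]; ring
  have hgc : ∀ x, gridPoint d K (n x) ∈ cube d := fun x => mem_cube.2 fun i => by
    have h1 := (mem_cube.1 x.2.1 i).2
    have h2 := hhg x i
    exact ⟨by rw [hgrid]; positivity, by linarith [(hhK i x).1]⟩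
  set S := indices s (List.finRange d) with hS
  have hSs : ∀ α ∈ S, ∑ i, α i < s := fun α hα => (mem_indices.1 hα).2
  have hScard : S.card ≤ s ^ d := by
    simpa using card_indices_le (s := s) (List.nodup_finRange d)
  choose t ht htR using fun α : {α // α ∈ S} => Reach.term_fit hN hL hs hJ hnlt hh01
    (fun m => multiDeriv α.1 f (gridPoint d K m))
    (fun x => hb _ (hSs _ α.2).le _ (hgc x)) (hSs _ α.2)
  have hcells : Reach (d * (2 * N + 8)) (range fun i (x : X) => x.1 i) (1 + (L + L))
      (⋃ i ∈ (Finset.univ : Finset (Fin d)), {fun x : X => x.1 i, fun x => (k i x : ℝ)}) := by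
    refine (Reach.biUnion Finset.univ fun i _ =>
      (Reach.cell hN hL hKNL hδ hδK hK i).source ?_).mono (by simp)
    rintro _ rfl
    exact mem_affSpan ⟨i, rfl⟩
  have hterms : Reach (s ^ d * (8 * N + 10 + 2 * d)) (insert (fun x => (n x : ℝ)) (range h))
      (2 * L + 3 + L * (J + 2) + s * (J + 2)) (⋃ α ∈ S.attach, {t α}) := by
    refine (Reach.biUnion S.attach fun α _ => htR α).mono ?_
    rw [Finset.card_attach]
    exact Nat.mul_le_mul_right _ hScard
  refine ⟨fun x => ∑ α ∈ S.attach, (∏ i, ((α.1 i).factorial : ℝ))⁻¹ * t α x, fun x => ?_, ?_⟩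
  · have hT := taylor_list hs hf hb List.suffix_rfl (hgc x) x.2.1 (by simp)
      (κ := 1 / (K : ℝ)) (fun i => by have := hhg x i; linarith [(hhK i x).1])
      (fun i => by rw [hhg]; exact (hhK i x).2) (by positivity)
    rw [List.length_finRange, ← hS, ← Finset.sum_attach] at hT
    -- Each term costs `3 K^{-s}`; with the Taylor error this makes the factor 4.
    have hE : 3 / ((2 * N : ℕ) : ℝ) ^ J ≤ 3 * (1 / (K : ℝ)) ^ s := by
      rw [div_eq_mul_one_div, one_div_pow]
      gcongr
      exact_mod_cast hJK
    have hsum : |∑ α ∈ S.attach, (∏ i, ((α.1 i).factorial : ℝ))⁻¹ * t α x -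
        ∑ α ∈ S.attach, multiDeriv α.1 f (gridPoint d K (n x)) *
          ∏ i, ((x.1 i - gridPoint d K (n x) i) ^ α.1 i / ((α.1 i).factorial : ℝ))| ≤
        ((s : ℝ) + 1) ^ d * (3 * (1 / (K : ℝ)) ^ s) := by
      rw [← Finset.sum_sub_distrib]
      refine (Finset.abs_sum_le_sum_abs _ _).trans ?_
      calc _ ≤ ∑ α ∈ S.attach, 3 * (1 / (K : ℝ)) ^ s := by
            refine Finset.sum_le_sum fun α _ => ?_
            have hfac : (1 : ℝ) ≤ ∏ i, ((α.1 i).factorial : ℝ) := by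
              exact_mod_cast Finset.prod_pos fun i _ => Nat.factorial_pos (α.1 i)
            have heq : (∏ i, ((α.1 i).factorial : ℝ))⁻¹ * t α x -
                multiDeriv α.1 f (gridPoint d K (n x)) *
                  ∏ i, ((x.1 i - gridPoint d K (n x) i) ^ α.1 i / ((α.1 i).factorial : ℝ)) =
                (∏ i, ((α.1 i).factorial : ℝ))⁻¹ * (t α x -
                  multiDeriv α.1 f (gridPoint d K (n x)) * ∏ i, h i x ^ α.1 i) := by
              simp only [hhg]
              rw [Finset.prod_div_distrib]
              ring
            rw [heq, abs_mul, abs_of_nonneg (by positivity)]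
            exact (mul_le_of_le_one_left (abs_nonneg _) (inv_le_one_of_one_le₀ hfac)).trans
              ((ht α x).trans hE)
        _ = (S.card : ℝ) * (3 * (1 / (K : ℝ)) ^ s) := by
          rw [Finset.sum_const, Finset.card_attach, nsmul_eq_mul]
        _ ≤ _ := by
          gcongr
          calc (S.card : ℝ) ≤ (s : ℝ) ^ d := by exact_mod_cast hScard
            _ ≤ _ := by gcongr; linarith
    rw [abs_sub_comm] at hT
    refine (abs_sub_le _ _ _).trans ((add_le_add hsum hT).trans_eq ?_)
    ring
  · refine ((hcells.mono (le_max_right _ _)).trans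
      ((hterms.mono (le_max_left _ _)).source ?_)).target ?_
    · have hxi : ∀ i : Fin d, (fun x : X => x.1 i) ∈ affSpan
          (⋃ i ∈ (Finset.univ : Finset (Fin d)), {fun x : X => x.1 i, fun x => (k i x : ℝ)}) :=
        fun i => mem_affSpan (mem_biUnion (Finset.mem_univ i) (Or.inl rfl))
      have hki : ∀ i : Fin d, (fun x : X => (k i x : ℝ)) ∈ affSpan
          (⋃ i ∈ (Finset.univ : Finset (Fin d)), {fun x : X => x.1 i, fun x => (k i x : ℝ)}) :=
        fun i => mem_affSpan (mem_biUnion (Finset.mem_univ i) (Or.inr rfl))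
      refine insert_subset ?_ ?_
      · exact affSpan_congr _ (affSpan_sum Finset.univ fun i _ => affSpan_mul _ (hki i)) hnsum
      · rintro _ ⟨i, rfl⟩
        exact affSpan_sub (hxi i) (affSpan_mul _ (hki i))
    · rintro _ rfl
      exact affSpan_sum _ fun α hα => affSpan_mul _ (mem_affSpan (mem_biUnion hα rfl))

end Main

end ReLUApprox

theorem mainTheorem5 (d s : ℕ) (hd : 1 ≤ d) (hs : 1 ≤ s)
    (f : (Fin d → ℝ) → ℝ) (hf : ContDiffOn ℝ (s : ℕ∞) f (ReLUApprox.cube d))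
    (hbound : ∀ α : Fin d → ℕ, ∑ i, α i ≤ s →
      eLpNorm (ReLUApprox.multiDeriv α f) ∞ (volume.restrict (ReLUApprox.cube d)) ≤ 1)
    (N L : ℕ) (hN : 1 ≤ N) (hL : 1 ≤ L)
    (δ : ℝ) (hδ : 0 < δ) (hδK : δ ≤ 1 / (3 * (ReLUApprox.gridSize d N L : ℝ))) :
    ∃ φ : (Fin d → ℝ) → ℝ,
      ReLUApprox.Implementable φ
        (16 * (s : ℝ) ^ (d + 1) * d * (N + 2) * Real.logb 2 (8 * N))
        (18 * (s : ℝ) ^ 2 * (L + 2) * Real.logb 2 (4 * L)) ∧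
      ∀ x ∈ ReLUApprox.cube d \ ReLUApprox.triflingRegion d (ReLUApprox.gridSize d N L) δ,
        |φ x - f x| ≤ 84 * ((s : ℝ) + 1) ^ d * 8 ^ s *
          (N : ℝ) ^ (-(2 * (s : ℝ) / d)) * (L : ℝ) ^ (-(2 * (s : ℝ) / d)) := by
  open ReLUApprox in
  have hb : ∀ α : Fin d → ℕ, ∑ i, α i ≤ s → ∀ x ∈ cube d, |multiDeriv α f x| ≤ 1 :=
    fun α hα => abs_le_one_of_eLpNorm (continuousOn_multiDeriv hf hα) (hbound α hα)
  -- From `N L ≤ (2N)^(⌊log₂ L⌋ + 1)` and `K ≤ (N L)²`, this many digits give `K^s ≤ (2N)^J`. The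
  -- base `2N` is at least 2 even for `N = 1`.
  set J := 2 * s * (Nat.log 2 L + 1) with hJdef
  have hKd := gridSize_pow_le (N := N) (L := L) hd
  have hJ4 : 4 ^ s ≤ (2 * N) ^ J := by
    calc 4 ^ s = 2 ^ (2 * s) := by rw [pow_mul]; norm_num
      _ ≤ (2 * N) ^ (2 * s) := Nat.pow_le_pow_left (by omega) _
      _ ≤ (2 * N) ^ J := Nat.pow_le_pow_right (by omega) (Nat.le_mul_of_pos_right _ (by omega))
  have hJK : gridSize d N L ^ s ≤ (2 * N) ^ J := by
    have hle := le_two_mul_pow_log N L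
    calc gridSize d N L ^ s ≤ (N * L * (N * L)) ^ s :=
          Nat.pow_le_pow_left ((Nat.le_self_pow (by omega) _).trans hKd) _
      _ ≤ ((2 * N) ^ (Nat.log 2 L + 1) * (2 * N) ^ (Nat.log 2 L + 1)) ^ s :=
          Nat.pow_le_pow_left (Nat.mul_le_mul hle hle) _
      _ = (2 * N) ^ J := by rw [← pow_add, ← pow_mul, hJdef]; congr 1; ring
  obtain ⟨φ, hφ, hR⟩ := Reach.taylor_fit hd hs hN hL (gridSize_pos hN hL) hKd hJ4 hJK hδ hδK hf hb
  obtain ⟨net, hw, hdep, hnet⟩ := hR.exists_net _ rfl (mem_singleton φ)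
  refine ⟨fun x => net.eval x 0, ⟨net, ?_, ?_, fun _ => rfl⟩, fun x hx => ?_⟩
  · exact width_bound hN hd hs (le_max_iff.1 hw)
  · rw [hdep]
    exact depth_bound hL hs
  · have hx' := hφ ⟨x, hx⟩
    rw [hnet] at hx'
    refine hx'.trans ?_
    have hinv := inv_gridSize_pow_le (d := d) hN hL s
    calc 4 * (((s : ℝ) + 1) ^ d * (1 / (gridSize d N L : ℝ)) ^ s)
        ≤ 84 * (((s : ℝ) + 1) ^ d * (8 ^ s *
          ((N : ℝ) ^ (-(2 * (s : ℝ) / d)) * (L : ℝ) ^ (-(2 * (s : ℝ) / d))))) := by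
          gcongr
          norm_num
      _ = _ := by ring
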